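/- Modules are left modules. For a ring $R$, let $\mathrm{mod}\,R$ be the class of $R$-modules that have a projective resolution by finitely generated projective modules. For $R$-modules $M,N$ and an integer $t\ge 0$ write $N\in M^{>t}$ (equivalently $M\in{}^{>t}N$) if $\mathrm{Ext}_R^i(M,N)=0$ for all $i>t$, and $N\in M^{\gg 0}$ (equivalently $M\in{}^{\gg 0}N$) if this holds for some $t>0$. Let $\mathrm{lAb}|_{\mathrm{mod}\,R}M$ (resp. $\mathrm{rAb}|_{\mathrm{mod}\,R}M$) be the least integer $t\ge 0$ with $M^{\gg 0}\cap\mathrm{mod}\,R=M^{>t}\cap\mathrm{mod}\,R$ (resp. ${}^{\gg 0}M\cap\mathrm{mod}\,R={}^{>t}M\cap\mathrm{mod}\,R$), or $\infty$ if there is none, and let $$\mathrm{gAb}\,R=\sup\{\mathrm{lAb}|_{\mathrm{mod}\,R}M : M\in\mathrm{mod}\,R\}=\sup\{\mathrm{rAb}|_{\mathrm{mod}\,R}M : M\in\mathrm{mod}\,R\}.$$ For a module $Y$, $\mathrm{add}\,Y$ is the class of modules isomorphic to a direct summand of a finite direct sum of copies of $Y$. A module $M$ has an *ultimately closed projective resolution*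 if it has a projective resolution with syzygies $\Omega^0M=M,\Omega^1M,\Omega^2M,\dots$ such that for some $m$ there is an isomorphism $\Omega^mM\cong\bigoplus_i M_i$ in which each $M_i$ lies in $\mathrm{add}(\Omega^{m_i}M)$ for some $m_i<m$. An *ultimately closed injective resolution* is defined in the same way by an injective resolution and its cosyzygies $\Omega^{-n}M$. The ring $R$ is of *projective* (resp. *injective*) *ultimately closed type* if every finitely generated $R$-module has an ultimately closed projective (resp. injective) resolution. An artin algebra is a ring that is a finitely generated module over a commutative artinian ring acting centrally, and a ring is of finite representation type if it has only finitely many finitely generated indecomposable modules up to isomorphism. $\mathrm{Rad}$ denotes the Jacobson radical. A module $T$ is *tilting* if (T1) $T\in\mathrm{mod}\,R$ and $T$ has finite projective dimension, (T2) $\mathrm{Ext}_R^i(T,T)=0$ for all $i>0$, and (T3) there is an exact sequence $0\to R\to T_0\to\cdots\to T_n\to 0$ for some $n\ge 0$ with every $T_i\in\mathrm{add}\,T$. The statement (EWTC) for $R$ says: every $T\in\mathrm{mod}\,R$ that satisfies (T2) and (T3) is tilting. **Proposition.** Let $R$ be an artin algebra. (1) If $R$ is of projective (resp. injective) ultimately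 closed type, then $\mathrm{lAb}|_{\mathrm{mod}\,R}M<\infty$ (resp. $\mathrm{rAb}|_{\mathrm{mod}\,R}M<\infty$) for every $M\in\mathrm{mod}\,R$. In particular, (EWTC) holds for $R$ if $R$ is of projective ultimately closed type. (2) If, for some integer $m\ge 0$, $R/\mathrm{Rad}^m(R)$ is of finite representation type and $\mathrm{Rad}^{m+1}(R)=0$, then $\mathrm{gAb}\,R<\infty$. -/

import Mathlib

open CategoryTheory
open scoped DirectSum

universe u

namespace AuslanderBound

section Basic

variable {R : Type u} [Ring R]

/-- `mod R`: the modules that have a projective resolution all of whose terms are finitely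
generated. -/
def IsMod (M : ModuleCat.{u} R) : Prop :=
  ∃ P : ProjectiveResolution M, ∀ n, Module.Finite R (P.complex.X n)

/-- `N ∈ M^{>t}`, equivalently `M ∈ ^{>t}N`: `Ext_R^i(M, N) = 0` for all `i > t`. -/
def ExtVanishesAbove (M N : ModuleCat.{u} R) (t : ℕ) : Prop :=
  ∀ i : ℕ, t < i → Subsingleton (Abelian.Ext M N i)

/-- `N ∈ M^{≫0}`, equivalently `M ∈ ^{≫0}N`: `N ∈ M^{>t}` for some `t > 0`. -/
def ExtVanishesEventually (M N : ModuleCat.{u} R) : Prop :=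
  ∃ t : ℕ, 0 < t ∧ ExtVanishesAbove M N t

/-- The left Auslander bound of `M` relative to the class `C`: the least `t : ℕ` with
`M^{≫0} ∩ C = M^{>t} ∩ C`, and `⊤` if there is none. -/
noncomputable def lAb (C : ModuleCat.{u} R → Prop) (M : ModuleCat.{u} R) : ℕ∞ :=
  ⨅ (t : ℕ) (_ : ∀ N, C N → (ExtVanishesEventually M N ↔ ExtVanishesAbove M N t)), (t : ℕ∞)

/-- The right Auslander bound of `M` relative to the class `C`: the least `t : ℕ` with
`^{≫0}M ∩ C = ^{>t}M ∩ C`, and `⊤` if there is none. -/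
noncomputable def rAb (C : ModuleCat.{u} R → Prop) (M : ModuleCat.{u} R) : ℕ∞ :=
  ⨅ (t : ℕ) (_ : ∀ N, C N → (ExtVanishesEventually N M ↔ ExtVanishesAbove N M t)), (t : ℕ∞)

/-- The supremum of the left Auslander bounds, relative to `C`, of the modules in `C`. -/
noncomputable def glAb (C : ModuleCat.{u} R → Prop) : ℕ∞ :=
  ⨆ (M : ModuleCat.{u} R) (_ : C M), lAb C M

/-- The supremum of the right Auslander bounds, relative to `C`, of the modules in `C`. -/
noncomputable def grAb (C : ModuleCat.{u} R → Prop) : ℕ∞ :=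
  ⨆ (M : ModuleCat.{u} R) (_ : C M), rAb C M

theorem ExtVanishesAbove.mono {M N : ModuleCat.{u} R} {s t : ℕ} (h : ExtVanishesAbove M N s)
    (hst : s ≤ t) : ExtVanishesAbove M N t :=
  fun i hi => h i (lt_of_le_of_lt hst hi)

theorem ExtVanishesAbove.eventually {M N : ModuleCat.{u} R} {t : ℕ}
    (h : ExtVanishesAbove M N t) : ExtVanishesEventually M N :=
  ⟨t + 1, t.succ_pos, h.mono t.le_succ⟩

theorem lAb_le_iff (C : ModuleCat.{u} R → Prop) (M : ModuleCat.{u} R) (t : ℕ) :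
    lAb C M ≤ t ↔ ∀ N, C N → ExtVanishesEventually M N → ExtVanishesAbove M N t := by
  constructor
  · intro h N hN hMN
    by_contra hcon
    have : ((t + 1 : ℕ) : ℕ∞) ≤ lAb C M := by
      refine le_iInf₂ fun s hs => ?_
      by_contra hlt
      rw [Nat.cast_le, not_le, Nat.lt_succ_iff] at hlt
      exact hcon (((hs N hN).1 hMN).mono hlt)
    have h2 := this.trans h
    rw [Nat.cast_le] at h2
    omega
  · intro h
    exact iInf₂_le t fun N hN => ⟨h N hN, fun h' => h'.eventually⟩

theorem rAb_le_iff (C : ModuleCat.{u} R → Prop) (M : ModuleCat.{u} R) (t : ℕ) :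
    rAb C M ≤ t ↔ ∀ N, C N → ExtVanishesEventually N M → ExtVanishesAbove N M t := by
  constructor
  · intro h N hN hMN
    by_contra hcon
    have : ((t + 1 : ℕ) : ℕ∞) ≤ rAb C M := by
      refine le_iInf₂ fun s hs => ?_
      by_contra hlt
      rw [Nat.cast_le, not_le, Nat.lt_succ_iff] at hlt
      exact hcon (((hs N hN).1 hMN).mono hlt)
    have h2 := this.trans h
    rw [Nat.cast_le] at h2
    omega
  · intro h
    exact iInf₂_le t fun N hN => ⟨h N hN, fun h' => h'.eventually⟩

/-- The two suprema agree, so that each of them is "the" global Auslander bound of `C`. -/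
theorem glAb_eq_grAb (C : ModuleCat.{u} R → Prop) : glAb C = grAb C := by
  have key : ∀ t : ℕ, glAb C ≤ t ↔ grAb C ≤ t := by
    intro t
    simp only [glAb, grAb, iSup_le_iff, lAb_le_iff, rAb_le_iff]
    exact ⟨fun h M hM N hN => h N hN M hM, fun h M hM N hN => h N hN M hM⟩
  apply le_antisymm
  · cases hg : grAb C with
    | top => exact le_top
    | coe t => exact (key t).2 hg.le
  · cases hg : glAb C with
    | top => exact le_top
    | coe t => exact (key t).1 hg.le

variable (R) in
/-- The global Auslander bound of `mod R`. -/
noncomputable def gAb : ℕ∞ :=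
  glAb (IsMod (R := R))

/-- `X ∈ add Y`: `X` is isomorphic to a direct summand of a finite direct sum of copies of `Y`. -/
def InAdd (X Y : ModuleCat.{u} R) : Prop :=
  ∃ (n : ℕ) (i : X →ₗ[R] (Fin n → Y)) (r : (Fin n → Y) →ₗ[R] X), r ∘ₗ i = LinearMap.id

/-- The `n`-th syzygy `Ω^n M` in the projective resolution `P` of `M`: it is `M` for `n = 0`, and
the image of the differential `P_{n} → P_{n-1}` for `n > 0`. -/
noncomputable def syzygy {M : ModuleCat.{u} R} (P : ProjectiveResolution M) : ℕ → ModuleCat.{u} R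
  | 0 => M
  | n + 1 => ModuleCat.of R (LinearMap.range (P.complex.d (n + 1) n).hom)

/-- The `n`-th cosyzygy `Ω^{-n} M` in the injective resolution `I` of `M`: it is `M` for `n = 0`,
and the image of the differential `I^{n-1} → I^{n}` for `n > 0`. -/
noncomputable def cosyzygy {M : ModuleCat.{u} R} (I : InjectiveResolution M) : ℕ → ModuleCat.{u} R
  | 0 => M
  | n + 1 => ModuleCat.of R (LinearMap.range (I.cocomplex.d n (n + 1)).hom)

/-- For a sequence `Ω` of modules: for some `m`, `Ω m ≅ ⨁ M_i` where each `M_i` lies in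
`add (Ω m_i)` for some `m_i < m`. -/
def UltimatelyClosed (Ω : ℕ → ModuleCat.{u} R) : Prop :=
  ∃ (m : ℕ) (ι : Type u) (X : ι → ModuleCat.{u} R),
    Nonempty (Ω m ≃ₗ[R] ⨁ i, X i) ∧ ∀ i, ∃ j < m, InAdd (X i) (Ω j)

/-- `M` has an ultimately closed projective resolution. -/
def HasUltimatelyClosedProjectiveResolution (M : ModuleCat.{u} R) : Prop :=
  ∃ P : ProjectiveResolution M, UltimatelyClosed (syzygy P)

/-- `M` has an ultimately closed injective resolution. -/
def HasUltimatelyClosedInjectiveResolution (M : ModuleCat.{u} R) : Prop :=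
  ∃ I : InjectiveResolution M, UltimatelyClosed (cosyzygy I)

variable (R) in
/-- `R` is of projective ultimately closed type. -/
def IsProjectiveUltimatelyClosedType : Prop :=
  ∀ M : ModuleCat.{u} R, Module.Finite R M → HasUltimatelyClosedProjectiveResolution M

variable (R) in
/-- `R` is of injective ultimately closed type. -/
def IsInjectiveUltimatelyClosedType : Prop :=
  ∀ M : ModuleCat.{u} R, Module.Finite R M → HasUltimatelyClosedInjectiveResolution M

variable (R) in
/-- `R` is of finite representation type: up to isomorphism there are only finitely many
finitely generated indecomposable `R`-modules. -/
def IsFiniteRepresentationType : Prop :=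
  ∃ (n : ℕ) (X : Fin n → ModuleCat.{u} R), ∀ M : ModuleCat.{u} R,
    Module.Finite R M → Indecomposable M → ∃ i, Nonempty (M ≅ X i)

/-- Finiteness of the projective dimension, part of the first tilting axiom. -/
def FinitePd (T : ModuleCat.{u} R) : Prop :=
  ∃ n : ℕ, HasProjectiveDimensionLE T n

/-- The second tilting axiom: `Ext_R^i(T, T) = 0` for all `i > 0`. -/
def Selforthogonal (T : ModuleCat.{u} R) : Prop :=
  ExtVanishesAbove T T 0

/-- The third tilting axiom: there is an exact sequence `0 → R → T_0 → ⋯ → T_n → 0` with each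
`T_i` in `add T`. The sequence is continued by zero modules beyond `T_n`. -/
def HasAddCoresolution (T : ModuleCat.{u} R) : Prop :=
  ∃ (n : ℕ) (X : ℕ → ModuleCat.{u} R) (f : R →ₗ[R] X 0) (d : ∀ i, X i →ₗ[R] X (i + 1)),
    (∀ i ≤ n, InAdd (X i) T) ∧ (∀ i, n < i → Subsingleton (X i)) ∧
    Function.Injective f ∧ Function.Exact f (d 0) ∧
    ∀ i, Function.Exact (d i) (d (i + 1))

/-- `T` is a tilting module. -/
structure IsTilting (T : ModuleCat.{u} R) : Prop where
  isMod : IsMod T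
  finitePd : FinitePd T
  selforthogonal : Selforthogonal T
  hasAddCoresolution : HasAddCoresolution T

variable (R) in
/-- The conjecture (EWTC) for the ring `R`: a module in `mod R` that satisfies the second and the
third tilting axiom is tilting. -/
def EWTC : Prop :=
  ∀ T : ModuleCat.{u} R, IsMod T → Selforthogonal T → HasAddCoresolution T → IsTilting T

end Basic

end AuslanderBound

/-! All bounds come from one finiteness principle, `exists_addGen_tail`. Suppose that all late
syzygies Ω^n of M lie, up to projectives, in add W for one finitely generated W. The endomorphisms
of W that are sums of maps through projectives or through Ω^j with j ≥ n form a descending chain of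
k-submodules of End(W), which is artinian over k, so the chain stabilizes. Hence a late Ω^t lies, up
to projectives, in the additive closure of {Ω^j : j ≥ n} for every n. By dimension shifting, if
Ext^i(M, N) vanishes for all large i, it vanishes for all i > t. Cosyzygies are treated dually.

Ultimate closedness supplies W: if Ω^m is built from earlier syzygies, then so is every later one.
The given resolution may have infinitely generated terms, so closedness is first carried over to
finitely generated (co)syzygies; on the injective side these exist because finitely generated
modules embed in finitely generated injectives. For (EWTC), the coresolution of R by add T gives
Ext^i(T, R) = 0 for large i, and inductively the same with each Ω^s T in place of R. The bound t
then forces Ext^1(Ω^t T, Ω^{t+1} T) = 0, so Ω^t T is projective.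

In part (2), the kernel of a projective cover is killed by Rad^m, hence is built from finitely many
modules. Their sum serves as W for each of them, and the maximum of their bounds plus one serves for
every module. -/

namespace AuslanderBound

/-! ### Ideals of morphisms and additive closure -/

section Factor

universe v w

variable {A : Type w} [Category.{v} A] [Preadditive A]

/-- The morphisms that are sums of morphisms factoring through objects of the class `C`. -/
def factorIdeal (C : A → Prop) (X Y : A) : AddSubgroup (X ⟶ Y) :=
  AddSubgroup.closure {f | ∃ Z, C Z ∧ ∃ (i : X ⟶ Z) (p : Z ⟶ Y), i ≫ p = f}

/-- `X` is a direct summand of a finite direct sum of objects of the class `C`; this is phrased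
through the identity of `X`. -/
def AddGen (C : A → Prop) (X : A) : Prop :=
  𝟙 X ∈ factorIdeal C X X

variable {C D : A → Prop} {W X Y Z : A}

theorem factor_mem (hZ : C Z) (i : X ⟶ Z) (p : Z ⟶ Y) : i ≫ p ∈ factorIdeal C X Y :=
  AddSubgroup.subset_closure ⟨Z, hZ, i, p, rfl⟩

theorem comp_mem_factorIdeal (f : W ⟶ X) {g : X ⟶ Y} (hg : g ∈ factorIdeal C X Y) :
    f ≫ g ∈ factorIdeal C W Y := by
  induction hg using AddSubgroup.closure_induction with
  | mem g hg =>
    obtain ⟨Z, hZ, i, p, rfl⟩ := hg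
    rw [← Category.assoc]
    exact factor_mem hZ _ _
  | zero => simp
  | add g h _ _ hg hh => rw [Preadditive.comp_add]; exact add_mem hg hh
  | neg g _ hg => rw [Preadditive.comp_neg]; exact neg_mem hg

theorem mem_factorIdeal_comp {f : W ⟶ X} (hf : f ∈ factorIdeal C W X) (g : X ⟶ Y) :
    f ≫ g ∈ factorIdeal C W Y := by
  induction hf using AddSubgroup.closure_induction with
  | mem f hf =>
    obtain ⟨Z, hZ, i, p, rfl⟩ := hf
    rw [Category.assoc]
    exact factor_mem hZ _ _
  | zero => simp
  | add g h _ _ hg hh => rw [Preadditive.add_comp]; exact add_mem hg hh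
  | neg g _ hg => rw [Preadditive.neg_comp]; exact neg_mem hg

theorem AddGen.of_mem (h : C X) : AddGen C X := by
  have := factor_mem h (𝟙 X) (𝟙 X)
  rwa [Category.comp_id] at this

theorem factorIdeal_le (h : ∀ Z, C Z → AddGen D Z) (X Y : A) :
    factorIdeal C X Y ≤ factorIdeal D X Y := by
  refine (AddSubgroup.closure_le _).2 ?_
  rintro _ ⟨Z, hZ, i, p, rfl⟩
  have := comp_mem_factorIdeal i (mem_factorIdeal_comp (h Z hZ) p)
  rwa [Category.id_comp] at this

theorem AddGen.trans (hX : AddGen C X) (h : ∀ Z, C Z → AddGen D Z) : AddGen D X :=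
  factorIdeal_le h X X hX

theorem AddGen.retract (hX : AddGen C X) (i : Y ⟶ X) (p : X ⟶ Y) (h : i ≫ p = 𝟙 Y) :
    AddGen C Y := by
  have := comp_mem_factorIdeal i (mem_factorIdeal_comp hX p)
  rwa [Category.id_comp, h] at this

theorem AddGen.trans_or {Q : A → Prop} (hX : AddGen (fun Z => C Z ∨ Q Z) X)
    (h : ∀ Z, C Z → AddGen (fun Z => D Z ∨ Q Z) Z) : AddGen (fun Z => D Z ∨ Q Z) X :=
  hX.trans fun Z hZ => hZ.elim (h Z) fun hq => .of_mem (Or.inr hq)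

theorem AddGen.or_right {Q : A → Prop} (hX : AddGen C X) : AddGen (fun Z => C Z ∨ Q Z) X :=
  hX.trans fun _ hZ => .of_mem (Or.inl hZ)

end Factor

/-! ### Syzygies modulo projectives, cosyzygies modulo injectives -/

section Syzygy

universe v w

variable {A : Type w} [Category.{v} A] [Abelian A] {C D : A → Prop}

/-- `K` is a first syzygy of `X`. -/
def IsSyzygy (K X : A) : Prop :=
  ∃ S : ShortComplex A, S.ShortExact ∧ Projective S.X₂ ∧ S.X₁ = K ∧ S.X₃ = X

/-- `K` is a first cosyzygy of `X`. -/
def IsCosyzygy (K X : A) : Prop :=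
  ∃ S : ShortComplex A, S.ShortExact ∧ Injective S.X₂ ∧ S.X₃ = K ∧ S.X₁ = X

/-- A summand of `f` through `Z` lifts to a map of syzygies through a syzygy of `Z`. A summand
through a projective lifts to the middle term of `T`, so its map on syzygies may be taken to be
zero. -/
theorem exists_lift_factorIdeal (h : ∀ Z, C Z → ∃ K, D K ∧ IsSyzygy K Z)
    {S T : ShortComplex A} (hS : S.ShortExact) (hT : T.ShortExact) [Projective S.X₂]
    {f : S.X₃ ⟶ T.X₃}
    (hf : f ∈ factorIdeal (fun Z => C Z ∨ Projective Z) S.X₃ T.X₃) :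
    ∃ (b : S.X₂ ⟶ T.X₂) (a : S.X₁ ⟶ T.X₁), b ≫ T.g = S.g ≫ f ∧ a ≫ T.f = S.f ≫ b ∧
      a ∈ factorIdeal (fun Z => D Z ∨ Projective Z) S.X₁ T.X₁ := by
  have := hS.mono_f
  have := hT.mono_f
  have := hS.epi_g
  have := hT.epi_g
  induction hf using AddSubgroup.closure_induction with
  | mem f hf =>
    obtain ⟨Z, hZ | hZ, i, p, rfl⟩ := hf
    · obtain ⟨_, hK, U, hU, hP, rfl, rfl⟩ := h Z hZ
      have := hU.mono_f
      have := hU.epi_g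
      have e₁ : Projective.factorThru (S.g ≫ i) U.g ≫ U.g = S.g ≫ i :=
        Projective.factorThru_comp _ _
      have e₂ : Projective.factorThru (U.g ≫ p) T.g ≫ T.g = U.g ≫ p :=
        Projective.factorThru_comp _ _
      set b₁ := Projective.factorThru (S.g ≫ i) U.g
      set b₂ := Projective.factorThru (U.g ≫ p) T.g
      have z₁ : (S.f ≫ b₁) ≫ U.g = 0 := by rw [Category.assoc, e₁, S.zero_assoc, Limits.zero_comp]
      have z₂ : (U.f ≫ b₂) ≫ T.g = 0 := by rw [Category.assoc, e₂, U.zero_assoc, Limits.zero_comp]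
      refine ⟨b₁ ≫ b₂, hU.exact.lift _ z₁ ≫ hT.exact.lift _ z₂, ?_, ?_,
        factor_mem (C := fun Z => D Z ∨ Projective Z) (Or.inl hK) _ _⟩
      · rw [Category.assoc, e₂, reassoc_of% e₁]
      · rw [Category.assoc, hT.exact.lift_f, ← Category.assoc, hU.exact.lift_f, Category.assoc]
    · refine ⟨S.g ≫ i ≫ Projective.factorThru p T.g, 0, ?_, ?_, zero_mem _⟩
      · rw [Category.assoc, Category.assoc, Projective.factorThru_comp]
      · rw [S.zero_assoc, Limits.zero_comp, Limits.zero_comp]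
  | zero => exact ⟨0, 0, by simp, by simp, zero_mem _⟩
  | add f f' _ _ h h' =>
    obtain ⟨b, a, h₁, h₂, h₃⟩ := h
    obtain ⟨b', a', h₁', h₂', h₃'⟩ := h'
    exact ⟨b + b', a + a', by simp [h₁, h₁'], by simp [h₂, h₂'], add_mem h₃ h₃'⟩
  | neg f _ h =>
    obtain ⟨b, a, h₁, h₂, h₃⟩ := h
    exact ⟨-b, -a, by simp [h₁], by simp [h₂], neg_mem h₃⟩

theorem AddGen.syzygy (h : ∀ Z, C Z → ∃ K, D K ∧ IsSyzygy K Z) {K X : A} (hK : IsSyzygy K X)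
    (hX : AddGen (fun Z => C Z ∨ Projective Z) X) : AddGen (fun Z => D Z ∨ Projective Z) K := by
  obtain ⟨S, hS, hP, rfl, rfl⟩ := hK
  have := hS.mono_f
  obtain ⟨b, a, h₁, h₂, h₃⟩ := exists_lift_factorIdeal h hS hS hX
  -- Both `𝟙` and `b` lift the identity of `S.X₃`, so their difference lands in `S.X₁`; therefore `𝟙
  -- - a` factors through the projective `S.X₂`.
  have z : (𝟙 S.X₂ - b) ≫ S.g = 0 := by simp [h₁]
  have e : 𝟙 S.X₁ = S.f ≫ hS.exact.lift _ z + a := by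
    rw [← cancel_mono S.f, Preadditive.add_comp, Category.assoc, hS.exact.lift_f, h₂]
    simp
  unfold AddGen
  rw [e]
  exact add_mem (factor_mem (C := fun Z => D Z ∨ Projective Z) (Or.inr hP) _ _) h₃

theorem exists_desc_factorIdeal (h : ∀ Z, C Z → ∃ K, D K ∧ IsCosyzygy K Z)
    {S T : ShortComplex A} (hS : S.ShortExact) (hT : T.ShortExact) [Injective T.X₂]
    {f : S.X₁ ⟶ T.X₁}
    (hf : f ∈ factorIdeal (fun Z => C Z ∨ Injective Z) S.X₁ T.X₁) :
    ∃ (b : S.X₂ ⟶ T.X₂) (a : S.X₃ ⟶ T.X₃), S.f ≫ b = f ≫ T.f ∧ S.g ≫ a = b ≫ T.g ∧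
      a ∈ factorIdeal (fun Z => D Z ∨ Injective Z) S.X₃ T.X₃ := by
  have := hS.mono_f
  have := hT.mono_f
  have := hS.epi_g
  have := hT.epi_g
  induction hf using AddSubgroup.closure_induction with
  | mem f hf =>
    obtain ⟨Z, hZ | hZ, i, p, rfl⟩ := hf
    · obtain ⟨_, hK, U, hU, hP, rfl, rfl⟩ := h Z hZ
      have := hU.mono_f
      have := hU.epi_g
      have e₁ : S.f ≫ Injective.factorThru (i ≫ U.f) S.f = i ≫ U.f :=
        Injective.comp_factorThru _ _
      have e₂ : U.f ≫ Injective.factorThru (p ≫ T.f) U.f = p ≫ T.f :=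
        Injective.comp_factorThru _ _
      set b₁ := Injective.factorThru (i ≫ U.f) S.f
      set b₂ := Injective.factorThru (p ≫ T.f) U.f
      have z₁ : S.f ≫ b₁ ≫ U.g = 0 := by rw [reassoc_of% e₁, U.zero, Limits.comp_zero]
      have z₂ : U.f ≫ b₂ ≫ T.g = 0 := by rw [reassoc_of% e₂, T.zero, Limits.comp_zero]
      refine ⟨b₁ ≫ b₂, hS.exact.desc _ z₁ ≫ hU.exact.desc _ z₂, ?_, ?_,
        factor_mem (C := fun Z => D Z ∨ Injective Z) (Or.inl hK) _ _⟩
      · rw [reassoc_of% e₁, e₂, Category.assoc]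
      · rw [hS.exact.g_desc_assoc, Category.assoc, hU.exact.g_desc, Category.assoc]
    · refine ⟨Injective.factorThru i S.f ≫ p ≫ T.f, 0, ?_, ?_, zero_mem _⟩
      · rw [← Category.assoc, Injective.comp_factorThru, Category.assoc]
      · simp
  | zero => exact ⟨0, 0, by simp, by simp, zero_mem _⟩
  | add f f' _ _ h h' =>
    obtain ⟨b, a, h₁, h₂, h₃⟩ := h
    obtain ⟨b', a', h₁', h₂', h₃'⟩ := h'
    exact ⟨b + b', a + a', by simp [h₁, h₁'], by simp [h₂, h₂'], add_mem h₃ h₃'⟩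
  | neg f _ h =>
    obtain ⟨b, a, h₁, h₂, h₃⟩ := h
    exact ⟨-b, -a, by simp [h₁], by simp [h₂], neg_mem h₃⟩

theorem AddGen.cosyzygy (h : ∀ Z, C Z → ∃ K, D K ∧ IsCosyzygy K Z) {K X : A}
    (hK : IsCosyzygy K X) (hX : AddGen (fun Z => C Z ∨ Injective Z) X) :
    AddGen (fun Z => D Z ∨ Injective Z) K := by
  obtain ⟨S, hS, hP, rfl, rfl⟩ := hK
  have := hS.epi_g
  obtain ⟨b, a, h₁, h₂, h₃⟩ := exists_desc_factorIdeal h hS hS hX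
  have z : S.f ≫ (𝟙 S.X₂ - b) = 0 := by simp [h₁]
  have e : 𝟙 S.X₃ = hS.exact.desc _ z ≫ S.g + a := by
    rw [← cancel_epi S.g, Preadditive.comp_add, hS.exact.g_desc_assoc, h₂]
    simp
  unfold AddGen
  rw [e]
  exact add_mem (factor_mem (C := fun Z => D Z ∨ Injective Z) (Or.inr hP) _ _) h₃

/-- Transport of an ultimate closedness relation from one sequence of iterated (co)syzygies to
another one. Here `Q` is the class of projectives (or injectives) and `Syz` is the relation
of being a first (co)syzygy. -/
theorem AddGen.of_iterate {Q : A → Prop} {Syz : A → A → Prop}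
    (hsyz : ∀ {C D : A → Prop}, (∀ Z, C Z → ∃ K, D K ∧ Syz K Z) → ∀ {K X : A}, Syz K X →
      AddGen (fun Z => C Z ∨ Q Z) X → AddGen (fun Z => D Z ∨ Q Z) K)
    {Ω : ℕ → A} (hΩ : ∀ n, Syz (Ω (n + 1)) (Ω n)) {m : ℕ}
    (hm : AddGen (fun Z => (∃ j < m, Z = Ω j) ∨ Q Z) (Ω m)) (n : ℕ) :
    AddGen (fun Z => (∃ j < m, Z = Ω j) ∨ Q Z) (Ω n) := by
  -- The relation survives taking `s` further (co)syzygies. Since `j + s < m + s`, strong induction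
  -- brings all indices below `m`.
  have shift : ∀ s, AddGen (fun Z => (∃ j < m, Z = Ω (j + s)) ∨ Q Z) (Ω (m + s)) := by
    intro s
    induction s with
    | zero => exact hm
    | succ s ih =>
      refine hsyz ?_ (hΩ (m + s)) ih
      rintro _ ⟨j, hj, rfl⟩
      exact ⟨_, ⟨j, hj, rfl⟩, hΩ (j + s)⟩
  induction n using Nat.strong_induction_on with
  | _ n ih =>
    rcases lt_or_ge n m with h | h
    · exact .of_mem (Or.inl ⟨n, h, rfl⟩)
    · obtain ⟨s, rfl⟩ := Nat.exists_eq_add_of_le h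
      refine (shift s).trans_or ?_
      rintro _ ⟨j, hj, rfl⟩
      exact ih _ (by omega)

/-- Two sequences of iterated (co)syzygies of the same object agree stably. -/
theorem AddGen.compare {Q : A → Prop} {Syz : A → A → Prop}
    (hsyz : ∀ {C D : A → Prop}, (∀ Z, C Z → ∃ K, D K ∧ Syz K Z) → ∀ {K X : A}, Syz K X →
      AddGen (fun Z => C Z ∨ Q Z) X → AddGen (fun Z => D Z ∨ Q Z) K)
    {Ω Ω' : ℕ → A} (hΩ : ∀ n, Syz (Ω (n + 1)) (Ω n)) (hΩ' : ∀ n, Syz (Ω' (n + 1)) (Ω' n))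
    (h0 : Ω 0 = Ω' 0) (n : ℕ) : AddGen (fun Z => Z = Ω' n ∨ Q Z) (Ω n) := by
  induction n with
  | zero => exact .of_mem (Or.inl h0)
  | succ n ih =>
    refine hsyz ?_ (hΩ n) ih
    rintro _ rfl
    exact ⟨_, rfl, hΩ' n⟩

end Syzygy

/-! ### Vanishing of Ext and dimension shifting -/

section Ext

universe v w t

variable {A : Type w} [Category.{v} A] [Abelian A] [HasExt.{t} A] {C D : A → Prop}

open Abelian

theorem AddGen.subsingleton_ext_left {X N : A} {i : ℕ} (hX : AddGen C X)
    (h : ∀ Z, C Z → Subsingleton (Ext Z N i)) : Subsingleton (Ext X N i) := by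
  have key : ∀ f ∈ factorIdeal C X X, ∀ e : Ext X N i, (Ext.mk₀ f).comp e (zero_add i) = 0 := by
    intro f hf e
    induction hf using AddSubgroup.closure_induction with
    | mem f hf =>
      obtain ⟨Z, hZ, a, p, rfl⟩ := hf
      have := h Z hZ
      rw [← Ext.mk₀_comp_mk₀_assoc, Subsingleton.elim ((Ext.mk₀ p).comp e (zero_add i)) 0,
        Ext.comp_zero]
    | zero => simp
    | add f g _ _ hf hg => rw [Ext.mk₀_add, Ext.add_comp, hf, hg, add_zero]
    | neg f _ hf => rw [Ext.mk₀_neg, Ext.neg_comp, hf, neg_zero]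
  refine subsingleton_of_forall_eq 0 fun e => ?_
  rw [← Ext.mk₀_id_comp e]
  exact key _ hX e

theorem AddGen.subsingleton_ext_right {X N : A} {i : ℕ} (hX : AddGen C X)
    (h : ∀ Z, C Z → Subsingleton (Ext N Z i)) : Subsingleton (Ext N X i) := by
  have key : ∀ f ∈ factorIdeal C X X, ∀ e : Ext N X i, e.comp (Ext.mk₀ f) (add_zero i) = 0 := by
    intro f hf e
    induction hf using AddSubgroup.closure_induction with
    | mem f hf =>
      obtain ⟨Z, hZ, a, p, rfl⟩ := hf
      have := h Z hZ
      rw [← Ext.mk₀_comp_mk₀, ← Ext.comp_assoc_of_second_deg_zero,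
        Subsingleton.elim (e.comp (Ext.mk₀ a) (add_zero i)) 0,
        Ext.zero_comp]
    | zero => simp
    | add f g _ _ hf hg => rw [Ext.mk₀_add, Ext.comp_add, hf, hg, add_zero]
    | neg f _ hf => rw [Ext.mk₀_neg, Ext.comp_neg, hf, neg_zero]
  refine subsingleton_of_forall_eq 0 fun e => ?_
  rw [← Ext.comp_mk₀_id e]
  exact key _ hX e

/-- The degree must be positive: Hom(K, N) only surjects onto Ext^1(X, N). -/
theorem IsSyzygy.subsingleton_ext_iff {K X : A} (h : IsSyzygy K X) (N : A) {i : ℕ} (hi : 0 < i) :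
    Subsingleton (Ext K N i) ↔ Subsingleton (Ext X N (i + 1)) := by
  obtain ⟨S, hS, hP, rfl, rfl⟩ := h
  obtain ⟨i, rfl⟩ : ∃ j, i = j + 1 := ⟨i - 1, by omega⟩
  constructor
  · intro _
    refine subsingleton_of_forall_eq 0 fun e => ?_
    obtain ⟨x, rfl⟩ := Ext.contravariant_sequence_exact₃ hS N e (Ext.eq_zero_of_projective _)
      (add_comm 1 (i + 1))
    rw [Subsingleton.elim x 0, Ext.comp_zero]
  · intro _
    refine subsingleton_of_forall_eq 0 fun e => ?_
    obtain ⟨x, rfl⟩ := Ext.contravariant_sequence_exact₁ hS N e (add_comm 1 (i + 1))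
      (Subsingleton.elim _ _)
    rw [Ext.eq_zero_of_projective x, Ext.comp_zero]

theorem IsCosyzygy.subsingleton_ext_iff {K X : A} (h : IsCosyzygy K X) (N : A) {i : ℕ}
    (hi : 0 < i) : Subsingleton (Ext N K i) ↔ Subsingleton (Ext N X (i + 1)) := by
  obtain ⟨S, hS, hP, rfl, rfl⟩ := h
  obtain ⟨i, rfl⟩ : ∃ j, i = j + 1 := ⟨i - 1, by omega⟩
  constructor
  · intro _
    refine subsingleton_of_forall_eq 0 fun e => ?_
    obtain ⟨x, rfl⟩ := Ext.covariant_sequence_exact₁ N hS e (Ext.eq_zero_of_injective _) rfl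
    rw [Subsingleton.elim x 0, Ext.zero_comp]
  · intro _
    refine subsingleton_of_forall_eq 0 fun e => ?_
    obtain ⟨x, rfl⟩ := Ext.covariant_sequence_exact₃ N hS e rfl (Subsingleton.elim _ _)
    rw [Ext.eq_zero_of_injective x, Ext.zero_comp]

theorem subsingleton_ext_iterate_syzygy {Ω : ℕ → A} (hΩ : ∀ n, IsSyzygy (Ω (n + 1)) (Ω n)) (N : A)
    (n : ℕ) {i : ℕ} (hi : 0 < i) :
    Subsingleton (Ext (Ω n) N i) ↔ Subsingleton (Ext (Ω 0) N (i + n)) := by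
  induction n generalizing i with
  | zero => rfl
  | succ n ih =>
    rw [(hΩ n).subsingleton_ext_iff N hi, ih (Nat.succ_pos i), Nat.succ_add_eq_add_succ]

theorem subsingleton_ext_iterate_cosyzygy {Ω : ℕ → A} (hΩ : ∀ n, IsCosyzygy (Ω (n + 1)) (Ω n))
    (N : A) (n : ℕ) {i : ℕ} (hi : 0 < i) :
    Subsingleton (Ext N (Ω n) i) ↔ Subsingleton (Ext N (Ω 0) (i + n)) := by
  induction n generalizing i with
  | zero => rfl
  | succ n ih =>
    rw [(hΩ n).subsingleton_ext_iff N hi, ih (Nat.succ_pos i), Nat.succ_add_eq_add_succ]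

end Ext

/-- The identity of `X` is its own square. Expanding both factors gives terms that pass through `Q`
or contain a composite `W ⟶ X ⟶ W`, to which `h` applies. -/
theorem AddGen.of_comp_mem {A : Type*} [Category* A] [Preadditive A] {E Q : A → Prop} {W X : A}
    (hX : AddGen (fun Z => Z = W ∨ Q Z) X)
    (h : ∀ (p : W ⟶ X) (i : X ⟶ W), p ≫ i ∈ factorIdeal (fun Z => E Z ∨ Q Z) W W) :
    AddGen (fun Z => E Z ∨ Q Z) X := by
  have key : ∀ f ∈ factorIdeal (fun Z => Z = W ∨ Q Z) X X,
      ∀ g ∈ factorIdeal (fun Z => Z = W ∨ Q Z) X X,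
      f ≫ g ∈ factorIdeal (fun Z => E Z ∨ Q Z) X X := by
    intro f hf g hg
    induction hf using AddSubgroup.closure_induction with
    | mem f hf =>
      induction hg using AddSubgroup.closure_induction with
      | mem g hg =>
        obtain ⟨Z, hZ | hZ, i, p, rfl⟩ := hf
        · subst hZ
          obtain ⟨Z', hZ' | hZ', i', p', rfl⟩ := hg
          · subst hZ'
            have := comp_mem_factorIdeal i (mem_factorIdeal_comp (h p i') p')
            simpa only [Category.assoc] using this
          · rw [← Category.assoc]
            exact factor_mem (C := fun Z => E Z ∨ Q Z) (Or.inr hZ') _ _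
        · rw [Category.assoc]
          exact factor_mem (C := fun Z => E Z ∨ Q Z) (Or.inr hZ) _ _
      | zero => simp
      | add g g' _ _ hg hg' => rw [Preadditive.comp_add]; exact add_mem hg hg'
      | neg g _ hg => rw [Preadditive.comp_neg]; exact neg_mem hg
    | zero => simp
    | add g g' _ _ hg hg' => rw [Preadditive.add_comp]; exact add_mem hg hg'
    | neg g _ hg => rw [Preadditive.neg_comp]; exact neg_mem hg
  have := key _ hX _ hX
  rwa [Category.comp_id] at this

/-! ### The descending chain in End(W) and the resulting bounds -/

section ArtinAlgebra

variable (k : Type*) {R : Type u} [CommRing k] [IsArtinianRing k] [Ring R] [Algebra k R]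
  [Module.Finite k R]

/-- Evaluation at finitely many `k`-generators of `V` embeds the maps into a finite power of `W`. -/
theorem isArtinian_linearMap_of_algebra (V W : Type*) [AddCommGroup V] [AddCommGroup W]
    [Module R V] [Module R W] [Module k V] [Module k W] [IsScalarTower k R V]
    [IsScalarTower k R W] [Module.Finite R V] [Module.Finite R W] :
    IsArtinian k (V →ₗ[R] W) := by
  have : Module.Finite k V := Module.Finite.trans R V
  have : Module.Finite k W := Module.Finite.trans R W
  have : IsArtinian k W := inferInstance
  obtain ⟨n, s, hs⟩ := Module.Finite.exists_fin (R := k) (M := V)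
  let φ : (V →ₗ[R] W) →ₗ[k] (Fin n → W) :=
    { toFun := fun f j => f (s j)
      map_add' := fun f g => rfl
      map_smul' := fun c f => rfl }
  refine isArtinian_of_injective φ fun f g hfg => ?_
  have : f.restrictScalars k = g.restrictScalars k :=
    LinearMap.ext_on_range hs fun j => congrFun hfg j
  exact LinearMap.ext fun x => LinearMap.congr_fun this x

include k in
theorem exists_addGen_tail {Q : ModuleCat.{u} R → Prop} (Ω : ℕ → ModuleCat.{u} R)
    (W : ModuleCat.{u} R) [Module.Finite R W] (n₁ : ℕ)
    (h : ∀ n, n₁ ≤ n → AddGen (fun Z => Z = W ∨ Q Z) (Ω n)) :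
    ∃ n₀, ∀ n, AddGen (fun Z => (∃ j, n ≤ j ∧ Z = Ω j) ∨ Q Z) (Ω n₀) := by
  let : Module k W := Module.compHom W (algebraMap k R)
  have : IsScalarTower k R W := ⟨fun c r x => by
    rw [Algebra.smul_def, mul_smul]; rfl⟩
  have : IsArtinian k (W →ₗ[R] W) := isArtinian_linearMap_of_algebra k W W
  have hmono : ∀ {n n' : ℕ}, n ≤ n' →
      factorIdeal (fun Z => (∃ j, n' ≤ j ∧ Z = Ω j) ∨ Q Z) W W ≤
        factorIdeal (fun Z => (∃ j, n ≤ j ∧ Z = Ω j) ∨ Q Z) W W := by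
    intro n n' hn
    refine factorIdeal_le ?_ W W
    rintro Z (⟨j, hj, rfl⟩ | hQ)
    · exact .of_mem (Or.inl ⟨j, hn.trans hj, rfl⟩)
    · exact .of_mem (Or.inr hQ)
  let I : ℕ → Submodule k (W →ₗ[R] W) := fun n =>
    { carrier := {f | ModuleCat.ofHom f ∈
        factorIdeal (fun Z => (∃ j, n ≤ j ∧ Z = Ω j) ∨ Q Z) W W}
      add_mem' := fun {f g} hf hg => by
        have : ModuleCat.ofHom f + ModuleCat.ofHom g ∈ factorIdeal _ W W := add_mem hf hg
        exact this
      zero_mem' := (factorIdeal (fun Z => (∃ j, n ≤ j ∧ Z = Ω j) ∨ Q Z) W W).zero_mem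
      smul_mem' := fun c f hf => by
        have := comp_mem_factorIdeal (ModuleCat.ofHom (c • (LinearMap.id : W →ₗ[R] W))) hf
        rw [← ModuleCat.ofHom_comp, LinearMap.comp_smul, LinearMap.comp_id] at this
        exact this }
  obtain ⟨a, ha⟩ := IsArtinian.monotone_stabilizes
    (⟨fun n => OrderDual.toDual (I n), fun n n' hn f hf => hmono hn hf⟩ :
      ℕ →o (Submodule k (W →ₗ[R] W))ᵒᵈ)
  -- The index is at least `n₁` so that `h` applies, and at least `a` so that a composite `W ⟶ Ω n₀
  -- ⟶ W` lies in the stable term of the chain, hence in every term.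
  refine ⟨max n₁ a, fun n => ?_⟩
  refine (h _ (le_max_left _ _)).of_comp_mem fun p i => ?_
  have h₁ : (p ≫ i).hom ∈ I a :=
    factor_mem (C := fun Z => (∃ j, a ≤ j ∧ Z = Ω j) ∨ Q Z)
      (Or.inl ⟨_, le_max_right _ _, rfl⟩) p i
  have h₂ : I a = I (max n a) := ha _ (le_max_right _ _)
  rw [h₂] at h₁
  exact hmono (le_max_left n a) h₁

include k in
theorem exists_bound_of_isSyzygy {Ω : ℕ → ModuleCat.{u} R}
    (hΩ : ∀ n, IsSyzygy (Ω (n + 1)) (Ω n))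
    (W : ModuleCat.{u} R) [Module.Finite R W] (n₁ : ℕ)
    (h : ∀ n, n₁ ≤ n → AddGen (fun Z => Z = W ∨ Projective Z) (Ω n)) :
    ∃ t, ∀ N, ExtVanishesEventually (Ω 0) N → ExtVanishesAbove (Ω 0) N t := by
  obtain ⟨t, ht⟩ := exists_addGen_tail k Ω W n₁ h
  refine ⟨t, fun N ⟨s, _, hs⟩ i hi => ?_⟩
  obtain ⟨j, hj, rfl⟩ : ∃ j, 0 < j ∧ i = j + t := ⟨i - t, by omega, by omega⟩
  rw [← subsingleton_ext_iterate_syzygy hΩ N t hj]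
  -- Use the tail from index `s`: degree `j > 0` at `Ω n` with `n ≥ s` corresponds to degree `j + n
  -- > s` at `Ω 0`, where Ext vanishes.
  refine (ht s).subsingleton_ext_left ?_
  rintro _ (⟨n, hn, rfl⟩ | hZ)
  · rw [subsingleton_ext_iterate_syzygy hΩ N n hj]
    exact hs _ (by omega)
  · obtain ⟨j, rfl⟩ : ∃ l, j = l + 1 := ⟨j - 1, by omega⟩
    exact subsingleton_of_forall_eq 0 Abelian.Ext.eq_zero_of_projective

include k in
theorem exists_bound_of_isCosyzygy {Ω : ℕ → ModuleCat.{u} R}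
    (hΩ : ∀ n, IsCosyzygy (Ω (n + 1)) (Ω n))
    (W : ModuleCat.{u} R) [Module.Finite R W] (n₁ : ℕ)
    (h : ∀ n, n₁ ≤ n → AddGen (fun Z => Z = W ∨ Injective Z) (Ω n)) :
    ∃ t, ∀ N, ExtVanishesEventually N (Ω 0) → ExtVanishesAbove N (Ω 0) t := by
  obtain ⟨t, ht⟩ := exists_addGen_tail k Ω W n₁ h
  refine ⟨t, fun N ⟨s, _, hs⟩ i hi => ?_⟩
  obtain ⟨j, hj, rfl⟩ : ∃ j, 0 < j ∧ i = j + t := ⟨i - t, by omega, by omega⟩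
  rw [← subsingleton_ext_iterate_cosyzygy hΩ N t hj]
  refine (ht s).subsingleton_ext_right ?_
  rintro _ (⟨n, hn, rfl⟩ | hZ)
  · rw [subsingleton_ext_iterate_cosyzygy hΩ N n hj]
    exact hs _ (by omega)
  · obtain ⟨j, rfl⟩ : ∃ l, j = l + 1 := ⟨j - 1, by omega⟩
    exact subsingleton_of_forall_eq 0 Abelian.Ext.eq_zero_of_injective

end ArtinAlgebra

/-! ### Finite and infinite direct sums -/

section Modules

variable {R : Type u} [Ring R]

/-- Each member of a finite family of modules is a direct summand of their product. -/
theorem addGen_pi {ι : Type*} [Finite ι] (X : ι → ModuleCat.{u} R) {W : ModuleCat.{u} R}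
    (e : W ≃ₗ[R] Π i, X i) (i : ι) : AddGen (fun Z => Z = W) (X i) := by
  classical
  have := factor_mem (C := fun Z => Z = W) rfl
    (ModuleCat.ofHom (e.symm.toLinearMap ∘ₗ LinearMap.single R (fun i => X i) i))
    (ModuleCat.ofHom (LinearMap.proj i ∘ₗ e.toLinearMap))
  unfold AddGen
  convert this using 1
  ext x
  simp

theorem exists_finite_addGen {ι : Type*} [Finite ι] (X : ι → ModuleCat.{u} R)
    (hX : ∀ i, Module.Finite R (X i)) :
    ∃ W : ModuleCat.{u} R, Module.Finite R W ∧ ∀ i, AddGen (fun Z => Z = W) (X i) := by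
  obtain ⟨n, ⟨e⟩⟩ := Finite.exists_equiv_fin ι
  refine ⟨ModuleCat.of R (Π i : Fin n, X (e.symm i)), ?_, fun i => ?_⟩
  · change Module.Finite R (Π i : Fin n, X (e.symm i))
    infer_instance
  · have := addGen_pi (fun i => X (e.symm i))
      (W := ModuleCat.of R (Π i : Fin n, X (e.symm i))) (LinearEquiv.refl R _) (e i)
    rwa [e.symm_apply_apply] at this

theorem InAdd.addGen {X Y : ModuleCat.{u} R} (h : InAdd X Y) : AddGen (fun Z => Z = Y) X := by
  obtain ⟨n, i, r, hr⟩ := h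
  classical
  have e : 𝟙 X = ∑ j, ModuleCat.ofHom (LinearMap.proj j ∘ₗ i) ≫
      ModuleCat.ofHom (r ∘ₗ LinearMap.single R (fun _ => (Y : Type u)) j) := by
    ext x
    have : r (∑ j, LinearMap.single R (fun _ => (Y : Type u)) j (i x j)) = x := by
      have h₂ := LinearMap.congr_fun hr x
      have h₃ : (∑ j, LinearMap.single R (fun _ => (Y : Type u)) j (i x j)) = i x :=
        LinearMap.sum_single_apply (fun _ => (Y : Type u)) (i x)
      rw [h₃]
      exact h₂
    rw [map_sum] at this
    rw [ModuleCat.hom_sum]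
    simpa using this.symm
  unfold AddGen
  rw [e]
  exact sum_mem fun j _ => factor_mem (C := fun Z => Z = Y) rfl _ _

/-- A map from a finitely generated module into a direct sum involves only finitely many
summands. -/
theorem mem_factorIdeal_directSum {ι : Type*} (X : ι → ModuleCat.{u} R) {V W : ModuleCat.{u} R}
    [Module.Finite R V] (e : W ≃ₗ[R] ⨁ i, X i) (f : V ⟶ W) :
    f ∈ factorIdeal (fun Z => ∃ i, Z = X i) V W := by
  classical
  obtain ⟨s, hs⟩ := (Module.Finite.fg_top : (⊤ : Submodule R V).FG)
  let T : Finset ι := s.biUnion fun v => DFinsupp.support (e (f v))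
  have key : ∀ v : V, ∀ i, i ∉ T → e (f v) i = 0 := by
    intro v i hi
    have hv : v ∈ Submodule.span R (s : Set V) := by rw [hs]; trivial
    induction hv using Submodule.span_induction with
    | mem v hv =>
      by_contra h
      exact hi (Finset.mem_biUnion.2 ⟨v, hv, DFinsupp.mem_support_iff.2 h⟩)
    | zero => simp
    | add v w _ _ h h' => rw [map_add, map_add, DirectSum.add_apply, h, h', add_zero]
    | smul r v _ h => rw [map_smul, map_smul, DirectSum.smul_apply, h, smul_zero]
  have eq : f = ∑ i ∈ T, ModuleCat.ofHom (DirectSum.component R ι (fun i => X i) i ∘ₗ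
      e.toLinearMap ∘ₗ f.hom) ≫
      ModuleCat.ofHom (e.symm.toLinearMap ∘ₗ DirectSum.lof R ι (fun i => X i) i) := by
    ext v
    apply e.injective
    have h₁ : e (f v) = ∑ i ∈ T, DirectSum.lof R ι (fun i => X i) i (e (f v) i) := by
      ext j
      rw [DFinsupp.finsetSum_apply]
      by_cases hj : j ∈ T
      · rw [Finset.sum_eq_single j]
        · exact (DirectSum.of_eq_same (β := fun i => X i) j _).symm
        · intro b _ hb
          exact DirectSum.of_eq_of_ne _ _ _ hb.symm
        · exact fun h => absurd hj h
      · rw [key v j hj, Finset.sum_eq_zero]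
        intro b hb
        refine DirectSum.of_eq_of_ne _ _ _ ?_
        rintro rfl
        exact hj hb
    rw [ModuleCat.hom_sum]
    simp only [LinearMap.sum_apply, map_sum]
    rw [h₁]
    refine Finset.sum_congr rfl fun i _ => ?_
    simp
    rfl
  rw [eq]
  exact sum_mem fun j _ => factor_mem (C := fun Z => ∃ i, Z = X i) ⟨j, rfl⟩ _ _

end Modules

/-! ### Syzygies of resolutions and ultimate closedness -/

section Resolutions

variable {R : Type u} [Ring R] {M : ModuleCat.{u} R}

theorem exists_shortExact_syzygy (P : ProjectiveResolution M) (n : ℕ) :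
    ∃ S : ShortComplex (ModuleCat.{u} R), S.ShortExact ∧ S.X₂ = P.complex.X n ∧
      S.X₁ = syzygy P (n + 1) ∧ S.X₃ = syzygy P n := by
  cases n with
  | zero =>
    refine ⟨ModuleCat.shortComplexOfCompEqZero (LinearMap.range (P.complex.d 1 0).hom).subtype
      (P.π.f 0).hom ?_, ModuleCat.shortComplex_shortExact _ ?_ ?_ ?_, rfl, rfl, rfl⟩
    · have h := P.exact₀.moduleCat_range_eq_ker
      ext ⟨x, hx⟩
      rw [h] at hx
      exact hx
    · have h := P.exact₀.moduleCat_range_eq_ker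
      intro x
      change x ∈ LinearMap.ker (P.π.f 0).hom ↔ _
      refine (SetLike.ext_iff.1 h x).symm.trans ?_
      exact ⟨fun hx => ⟨⟨x, hx⟩, rfl⟩, fun ⟨y, hy⟩ => hy ▸ y.2⟩
    · exact Subtype.val_injective
    · exact (ModuleCat.epi_iff_surjective (P.π.f 0)).1 inferInstance
  | succ n =>
    refine ⟨ModuleCat.shortComplexOfCompEqZero
      (LinearMap.range (P.complex.d (n + 2) (n + 1)).hom).subtype
      (P.complex.d (n + 1) n).hom.rangeRestrict ?_,
      ModuleCat.shortComplex_shortExact _ ?_ ?_ ?_, rfl, rfl, rfl⟩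
    · have h := (P.exact_succ n).moduleCat_range_eq_ker
      ext ⟨x, hx⟩
      rw [h] at hx
      exact hx
    · have h := (P.exact_succ n).moduleCat_range_eq_ker
      intro x
      refine Iff.trans (b := x ∈ LinearMap.ker (P.complex.d (n + 1) n).hom) ?_ ?_
      · exact Subtype.ext_iff
      · refine (SetLike.ext_iff.1 h x).symm.trans ?_
        exact ⟨fun hx => ⟨⟨x, hx⟩, rfl⟩, fun ⟨y, hy⟩ => hy ▸ y.2⟩
    · exact Subtype.val_injective
    · exact LinearMap.surjective_rangeRestrict _

theorem exists_shortExact_cosyzygy (I : InjectiveResolution M) (n : ℕ) :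
    ∃ S : ShortComplex (ModuleCat.{u} R), S.ShortExact ∧ S.X₂ = I.cocomplex.X n ∧
      S.X₃ = cosyzygy I (n + 1) ∧ S.X₁ = cosyzygy I n := by
  cases n with
  | zero =>
    refine ⟨ModuleCat.shortComplexOfCompEqZero (I.ι.f 0).hom
      (I.cocomplex.d 0 1).hom.rangeRestrict ?_,
      ModuleCat.shortComplex_shortExact _ ?_ ?_ ?_, rfl, rfl, rfl⟩
    · ext x
      exact congr($(I.ι_f_zero_comp_complex_d).hom x)
    · have h := I.exact₀.moduleCat_range_eq_ker
      intro x
      refine Iff.trans (b := x ∈ LinearMap.ker (I.cocomplex.d 0 1).hom) ?_ ?_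
      · exact Subtype.ext_iff
      · rw [← h]
        exact Iff.rfl
    · exact (ModuleCat.mono_iff_injective (I.ι.f 0)).1 inferInstance
    · exact LinearMap.surjective_rangeRestrict _
  | succ n =>
    refine ⟨ModuleCat.shortComplexOfCompEqZero
      (LinearMap.range (I.cocomplex.d n (n + 1)).hom).subtype
      (I.cocomplex.d (n + 1) (n + 2)).hom.rangeRestrict ?_,
      ModuleCat.shortComplex_shortExact _ ?_ ?_ ?_, rfl, rfl, rfl⟩
    · have h := (I.exact_succ n).moduleCat_range_eq_ker
      ext ⟨x, hx⟩
      rw [h] at hx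
      exact hx
    · have h := (I.exact_succ n).moduleCat_range_eq_ker
      intro x
      refine Iff.trans (b := x ∈ LinearMap.ker (I.cocomplex.d (n + 1) (n + 2)).hom) ?_ ?_
      · exact Subtype.ext_iff
      · refine (SetLike.ext_iff.1 h x).symm.trans ?_
        exact ⟨fun hx => ⟨⟨x, hx⟩, rfl⟩, fun ⟨y, hy⟩ => hy ▸ y.2⟩
    · exact Subtype.val_injective
    · exact LinearMap.surjective_rangeRestrict _

theorem isSyzygy_syzygy (P : ProjectiveResolution M) (n : ℕ) :
    IsSyzygy (syzygy P (n + 1)) (syzygy P n) := by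
  obtain ⟨S, hS, h₂, h₁, h₃⟩ := exists_shortExact_syzygy P n
  exact ⟨S, hS, h₂ ▸ P.projective n, h₁, h₃⟩

theorem isCosyzygy_cosyzygy (I : InjectiveResolution M) (n : ℕ) :
    IsCosyzygy (cosyzygy I (n + 1)) (cosyzygy I n) := by
  obtain ⟨S, hS, h₂, h₃, h₁⟩ := exists_shortExact_cosyzygy I n
  exact ⟨S, hS, h₂ ▸ I.injective n, h₃, h₁⟩

theorem finite_syzygy (P : ProjectiveResolution M) (hP : ∀ n, Module.Finite R (P.complex.X n))
    (n : ℕ) : Module.Finite R (syzygy P n) := by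
  obtain ⟨S, hS, h₂, h₁, h₃⟩ := exists_shortExact_syzygy P n
  have : Module.Finite R S.X₂ := h₂ ▸ hP n
  rw [← h₃]
  exact Module.Finite.of_surjective S.g.hom hS.moduleCat_surjective_g

theorem IsMod.finite (h : IsMod M) : Module.Finite R M := by
  obtain ⟨P, hP⟩ := h
  exact finite_syzygy P hP 0

/-- Only `V` has to be finitely generated; `W` will be a term of the given, possibly infinitely
generated, sequence of (co)syzygies. -/
theorem AddGen.of_directSum {Q : ModuleCat.{u} R → Prop} {ι : Type*} (X : ι → ModuleCat.{u} R)
    {V W : ModuleCat.{u} R} [Module.Finite R V] (e : W ≃ₗ[R] ⨁ i, X i)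
    (hV : AddGen (fun Z => Z = W ∨ Q Z) V) : AddGen (fun Z => (∃ i, Z = X i) ∨ Q Z) V := by
  have : factorIdeal (fun Z => Z = W ∨ Q Z) V V ≤
      factorIdeal (fun Z => (∃ i, Z = X i) ∨ Q Z) V V := by
    refine (AddSubgroup.closure_le _).2 ?_
    rintro _ ⟨Z, hZ | hZ, i, p, rfl⟩
    · subst hZ
      refine mem_factorIdeal_comp ?_ p
      exact factorIdeal_le (fun Z hZ => .of_mem (Or.inl hZ)) _ _
        (mem_factorIdeal_directSum X e i)
    · exact factor_mem (C := fun Z => (∃ i, Z = X i) ∨ Q Z) (Or.inr hZ) _ _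
  exact this hV

/-- If one sequence of iterated (co)syzygies of a module is ultimately closed, then any sequence of
finitely generated iterated (co)syzygies consists, up to projectives (injectives), of direct
summands of sums of copies of one finitely generated module. -/
theorem UltimatelyClosed.exists_addGen {Q : ModuleCat.{u} R → Prop}
    {Syz : ModuleCat.{u} R → ModuleCat.{u} R → Prop}
    (hsyz : ∀ {C D : ModuleCat.{u} R → Prop}, (∀ Z, C Z → ∃ K, D K ∧ Syz K Z) →
      ∀ {K X : ModuleCat.{u} R}, Syz K X →
      AddGen (fun Z => C Z ∨ Q Z) X → AddGen (fun Z => D Z ∨ Q Z) K)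
    {Ω Ω' : ℕ → ModuleCat.{u} R} (hΩ : ∀ n, Syz (Ω (n + 1)) (Ω n))
    (hΩ' : ∀ n, Syz (Ω' (n + 1)) (Ω' n)) (h0 : Ω 0 = Ω' 0)
    (hfin : ∀ n, Module.Finite R (Ω' n)) (h : UltimatelyClosed Ω) :
    ∃ W : ModuleCat.{u} R, Module.Finite R W ∧
      ∀ n, AddGen (fun Z => Z = W ∨ Q Z) (Ω' n) := by
  obtain ⟨m, ι, X, ⟨e⟩, hX⟩ := h
  -- Pass from `Ω' m` to `Ω m`, to the summands `X i`, to `Ω j`, and back to `Ω' j`, each time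
  -- modulo `Q`.
  have hm : AddGen (fun Z => (∃ j < m, Z = Ω' j) ∨ Q Z) (Ω' m) := by
    have := hfin m
    refine ((AddGen.compare hsyz hΩ' hΩ h0.symm m).of_directSum X e).trans_or ?_
    rintro _ ⟨i, rfl⟩
    obtain ⟨j, hj, hij⟩ := hX i
    refine hij.addGen.trans ?_
    rintro _ rfl
    refine (AddGen.compare hsyz hΩ hΩ' h0 j).trans_or ?_
    rintro _ rfl
    exact .of_mem (Or.inl ⟨j, hj, rfl⟩)
  obtain ⟨W, hW, hWX⟩ := exists_finite_addGen (fun j : Fin m => Ω' j) fun j => hfin j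
  refine ⟨W, hW, fun n => (AddGen.of_iterate hsyz hΩ' hm n).trans_or ?_⟩
  rintro _ ⟨j, hj, rfl⟩
  exact (hWX ⟨j, hj⟩).or_right

theorem exists_bound_of_hasUltimatelyClosedProjectiveResolution (k : Type*) [CommRing k]
    [IsArtinianRing k] [Algebra k R] [Module.Finite k R] (hM : IsMod M)
    (h : HasUltimatelyClosedProjectiveResolution M) :
    ∃ t, ∀ N, ExtVanishesEventually M N → ExtVanishesAbove M N t := by
  obtain ⟨P', hP'⟩ := hM
  obtain ⟨P, hP⟩ := h
  obtain ⟨W, hW, hWn⟩ := hP.exists_addGen AddGen.syzygy (isSyzygy_syzygy P) (isSyzygy_syzygy P')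
    rfl (finite_syzygy P' hP')
  exact exists_bound_of_isSyzygy k (isSyzygy_syzygy P') W 0 fun n _ => hWn n

end Resolutions

/-! ### Finite projective dimension for (EWTC) -/

section Tilting

open Abelian

variable {R : Type u} [Ring R]

theorem ExtVanishesAbove.of_shortExact {T : ModuleCat.{u} R} {S : ShortComplex (ModuleCat.{u} R)}
    (hS : S.ShortExact) {t : ℕ} (h₂ : ExtVanishesAbove T S.X₂ (t + 1))
    (h₃ : ExtVanishesAbove T S.X₃ t) : ExtVanishesAbove T S.X₁ (t + 1) := by
  intro i hi
  obtain ⟨i, rfl⟩ : ∃ j, i = j + 1 := ⟨i - 1, by omega⟩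
  have := h₂ (i + 1) hi
  have := h₃ i (by omega)
  refine subsingleton_of_forall_eq 0 fun e => ?_
  obtain ⟨x, rfl⟩ := Ext.covariant_sequence_exact₁ T hS e (Subsingleton.elim _ _) rfl
  rw [Subsingleton.elim x 0, Ext.zero_comp]

theorem ExtVanishesAbove.of_addGen {T X Y : ModuleCat.{u} R} {t : ℕ}
    (h : ExtVanishesAbove T Y t) (hX : AddGen (fun Z => Z = Y) X) : ExtVanishesAbove T X t :=
  fun i hi => hX.subsingleton_ext_right (by rintro _ rfl; exact h i hi)

theorem ExtVanishesAbove.of_subsingleton (T X : ModuleCat.{u} R) [Subsingleton X] (t : ℕ) :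
    ExtVanishesAbove T X t := by
  intro i _
  refine AddGen.subsingleton_ext_right (C := fun _ => False) ?_ (fun _ h => h.elim)
  unfold AddGen
  convert zero_mem (factorIdeal (fun _ => False) X X)
  ext x
  exact Subsingleton.elim (α := X) _ _

theorem HasAddCoresolution.extVanishesAbove {T : ModuleCat.{u} R} (h : HasAddCoresolution T)
    (hT : Selforthogonal T) : ∃ t, ExtVanishesAbove T (ModuleCat.of R R) t := by
  obtain ⟨n, X, f, d, hX, hX0, hf, hfd, hd⟩ := h
  have hXT : ∀ i t, ExtVanishesAbove T (X i) t := by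
    intro i t
    rcases le_or_gt i n with hi | hi
    · exact ExtVanishesAbove.mono (ExtVanishesAbove.of_addGen hT (hX i hi).addGen) t.zero_le
    · have := hX0 i hi
      exact .of_subsingleton T (X i) t
  -- The coresolution is cut at the images of `d j`, working down from `j = n`, where the image lies
  -- in `X (n + 1) = 0`.
  have key : ∀ l j, j + l = n →
      ExtVanishesAbove T (ModuleCat.of R (LinearMap.range (d j))) l := by
    intro l
    induction l with
    | zero =>
      intro j hj
      have := hX0 (j + 1) (by omega)
      have : Subsingleton (ModuleCat.of R (LinearMap.range (d j))) :=
        inferInstanceAs (Subsingleton (LinearMap.range (d j)))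
      exact .of_subsingleton _ _ _
    | succ l ih =>
      intro j hj
      refine ExtVanishesAbove.of_shortExact (S := ModuleCat.shortComplexOfCompEqZero
        (LinearMap.range (d j)).subtype (d (j + 1)).rangeRestrict ?_)
        (ModuleCat.shortComplex_shortExact _ ?_ ?_ ?_) (hXT (j + 1) _) (ih (j + 1) (by omega))
      · ext ⟨x, hx⟩
        exact (hd j x).2 hx
      · intro x
        refine Subtype.ext_iff.trans ((hd j x).trans ?_)
        exact ⟨fun hx => ⟨⟨x, hx⟩, rfl⟩, fun ⟨y, hy⟩ => hy ▸ y.2⟩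
      · exact Subtype.val_injective
      · exact LinearMap.surjective_rangeRestrict _
  refine ⟨n + 1, ExtVanishesAbove.of_shortExact (S := ModuleCat.shortComplexOfCompEqZero
    (N := X 0) f (d 0).rangeRestrict ?_) (ModuleCat.shortComplex_shortExact _ ?_ ?_ ?_)
    (hXT 0 _) (key n 0 (Nat.zero_add n))⟩
  · ext
    exact (hfd _).2 ⟨_, rfl⟩
  · intro x
    exact Subtype.ext_iff.trans (hfd x)
  · exact hf
  · exact LinearMap.surjective_rangeRestrict _

theorem addGen_of_projective (P : ModuleCat.{u} R) [Module.Finite R P] [Projective P] :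
    AddGen (fun Z => Z = ModuleCat.of R R) P := by
  have : Module.Projective R P := (IsProjective.iff_projective (P : Type u)).2 ‹_›
  obtain ⟨n, p, hp⟩ := Module.Finite.exists_fin' R P
  obtain ⟨s, hs⟩ := Module.projective_lifting_property p LinearMap.id hp
  exact InAdd.addGen ⟨n, s, p, hs⟩

theorem finitePd_of_bound {T : ModuleCat.{u} R} (hT : IsMod T) (hT₂ : Selforthogonal T)
    {r t : ℕ} (hR : ExtVanishesAbove T (ModuleCat.of R R) r)
    (ht : ∀ N, ExtVanishesEventually T N → ExtVanishesAbove T N t) : FinitePd T := by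
  obtain ⟨P, hP⟩ := hT
  -- The bound grows with `s`, which is harmless: `ht` needs only eventual vanishing and replaces it
  -- by the uniform `t`.
  have hv : ∀ s, ExtVanishesAbove T (syzygy P s) (r + s) := by
    intro s
    induction s with
    | zero => exact ExtVanishesAbove.mono hT₂ (Nat.zero_le _)
    | succ s ih =>
      obtain ⟨S, hS, h₂, h₁, h₃⟩ := exists_shortExact_syzygy P s
      rw [← h₃] at ih
      rw [← h₁]
      refine .of_shortExact hS ?_ ih
      rw [h₂]
      have := hP s
      exact (hR.of_addGen (addGen_of_projective _)).mono (Nat.le_add_right r (s + 1))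
  have h₁ : Subsingleton (Ext (syzygy P t) (syzygy P (t + 1)) 1) :=
    (subsingleton_ext_iterate_syzygy (isSyzygy_syzygy P) _ t Nat.one_pos).2
      (ht _ (hv (t + 1)).eventually _ (by omega))
  have hproj : Projective (syzygy P t) := by
    obtain ⟨S, hS, h, h', h''⟩ := exists_shortExact_syzygy P t
    rw [← h', ← h''] at h₁
    rw [← h'']
    have : Projective S.X₂ := h ▸ P.projective t
    -- The obstruction to lifting the identity along `S.g` lies in a zero Ext^1, so the sequence
    -- splits.
    obtain ⟨x, hx⟩ := Ext.covariant_sequence_exact₃ S.X₃ hS (Ext.mk₀ (𝟙 S.X₃)) rfl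
      (Subsingleton.elim _ _)
    obtain ⟨s, rfl⟩ := Ext.homEquiv₀.symm.surjective x
    refine Retract.projective (⟨s, S.g, ?_⟩ : Retract S.X₃ S.X₂)
    apply Ext.homEquiv₀.symm.injective
    simpa using hx
  refine ⟨t, HasProjectiveDimensionLT.mk fun i hi Y e => ?_⟩
  obtain ⟨j, rfl⟩ : ∃ j, i = (j + 1) + t := ⟨i - t - 1, by omega⟩
  have : Subsingleton (Ext T Y (j + 1 + t)) :=
    (subsingleton_ext_iterate_syzygy (isSyzygy_syzygy P) Y t j.succ_pos).1
      (subsingleton_of_forall_eq 0 Ext.eq_zero_of_projective)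
  exact Subsingleton.elim _ _

end Tilting

/-! ### Socles and injective hulls over an artinian ring -/

section Socle

variable {R : Type u} [Ring R]

/-- The submodule of elements annihilated by a two-sided ideal. -/
def annihilatedBy (I : Ideal R) [I.IsTwoSided] (V : Type*) [AddCommGroup V] [Module R V] :
    Submodule R V where
  carrier := {x | ∀ a ∈ I, a • x = 0}
  add_mem' := fun {x y} hx hy a ha => by rw [smul_add, hx a ha, hy a ha, add_zero]
  zero_mem' := fun a _ => smul_zero a
  smul_mem' := fun r x hx a ha => by rw [← mul_smul]; exact hx _ (I.mul_mem_right r ha)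

theorem isSemisimpleModule_of_jacobson_smul_eq_zero [IsArtinianRing R] (V : Type*) [AddCommGroup V]
    [Module R V] (h : ∀ a ∈ Ring.jacobson R, ∀ x : V, a • x = 0) : IsSemisimpleModule R V := by
  have hM : Module.IsTorsionBySet R V (Ring.jacobson R) := fun x a => h a a.2 x
  rw [← hM.isSemisimpleModule_iff]
  infer_instance

/-- For generators `a i` of `J ^ n`, the map `x ↦ (a i • x)` sends the part killed by `J ^ (n + 1)`
to a finite power of the part killed by `J`, and its kernel is the part killed by `J ^ n`. -/
theorem isNoetherian_annihilatedBy_pow (k : Type*) [CommRing k] [Algebra k R] [IsNoetherianRing R]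
    (J : Ideal R) [J.IsTwoSided] (V : Type*) [AddCommGroup V] [Module R V] [Module k V]
    [IsScalarTower k R V] (h : IsNoetherian k (annihilatedBy J V)) (n : ℕ) :
    IsNoetherian k (annihilatedBy (J ^ n) V) := by
  induction n with
  | zero =>
    have : Subsingleton (annihilatedBy (J ^ 0) V) := by
      refine subsingleton_of_forall_eq 0 fun x => Subtype.ext ?_
      have := x.2 1 (by rw [J.pow_zero, Ideal.one_eq_top]; trivial)
      rwa [one_smul] at this
    infer_instance
  | succ n ih =>
    obtain ⟨r, a, ha⟩ := Submodule.fg_iff_exists_fin_generating_family.1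
      (IsNoetherian.noetherian (J ^ n))
    have haJ : ∀ i, a i ∈ J ^ n := fun i => ha ▸ Submodule.subset_span ⟨i, rfl⟩
    have hmul : ∀ (x : annihilatedBy (J ^ (n + 1)) V) (i : Fin r),
        a i • (x : V) ∈ annihilatedBy J V := by
      intro x i b hb
      rw [← mul_smul]
      refine x.2 _ ?_
      rcases eq_or_ne n 0 with rfl | hn
      · rw [zero_add, Submodule.pow_one]
        exact J.mul_mem_right _ hb
      · rw [Submodule.pow_succ' J hn]
        exact Ideal.mul_mem_mul hb (haJ i)
    have hcomm : SMulCommClass k R V := IsScalarTower.to_smulCommClass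
    let g : annihilatedBy (J ^ (n + 1)) V →ₗ[k] (Fin r → annihilatedBy J V) :=
      { toFun := fun x i => ⟨a i • (x : V), hmul x i⟩
        map_add' := fun x y => funext fun i => Subtype.ext (smul_add _ _ _)
        map_smul' := fun c x => funext fun i => Subtype.ext (smul_comm (a i) c (x : V)) }
    have hle : annihilatedBy (J ^ n) V ≤ annihilatedBy (J ^ (n + 1)) V := fun x hx b hb =>
      hx b (Ideal.pow_le_pow_right n.le_succ hb)
    let f : annihilatedBy (J ^ n) V →ₗ[k] annihilatedBy (J ^ (n + 1)) V :=
      (Submodule.inclusion hle).restrictScalars k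
    refine isNoetherian_of_range_eq_ker f g ?_
    ext x
    constructor
    · rintro ⟨y, rfl⟩
      exact funext fun i => Subtype.ext (y.2 _ (haJ i))
    · intro hx
      refine ⟨⟨x, fun b hb => ?_⟩, rfl⟩
      rw [← ha] at hb
      induction hb using Submodule.span_induction with
      | mem b hb =>
        obtain ⟨i, rfl⟩ := hb
        exact congr_arg Subtype.val (congr_fun hx i)
      | zero => exact zero_smul R _
      | add b c _ _ hb hc => rw [add_smul, hb, hc, add_zero]
      | smul c b _ hb => rw [smul_eq_mul, mul_smul, hb, smul_zero]

theorem finite_of_isNoetherian_annihilatedBy (k : Type*) [CommRing k] [Algebra k R]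
    [IsArtinianRing R]
    (V : Type*) [AddCommGroup V] [Module R V] [Module k V] [IsScalarTower k R V]
    (h : IsNoetherian k (annihilatedBy (Ring.jacobson R) V)) : Module.Finite R V := by
  obtain ⟨n, hn⟩ := IsSemiprimaryRing.isNilpotent (R := R)
  have := isNoetherian_annihilatedBy_pow k (Ring.jacobson R) V h n
  have htop : annihilatedBy (Ring.jacobson R ^ n) V = ⊤ := by
    rw [eq_top_iff]
    intro x _ a ha
    rw [hn] at ha
    rw [(Submodule.mem_bot R).1 ha, zero_smul]
  rw [htop] at this
  have : Module.Finite k (⊤ : Submodule R V) := inferInstance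
  have : Module.Finite R (⊤ : Submodule R V) := Module.Finite.of_restrictScalars_finite k R _
  exact Module.Finite.equiv (Submodule.topEquiv (R := R) (M := V))

/-- A finitely generated submodule of an injective module is contained in a direct summand with the
same socle. -/
theorem exists_retract_same_socle [IsArtinianRing R] {V : Type u} [AddCommGroup V] [Module R V]
    (hV : Module.Injective R V) (M : Submodule R V) :
    ∃ E : Submodule R V, M ≤ E ∧ (∀ x ∈ E, (∀ a ∈ Ring.jacobson R, a • x = 0) → x ∈ M) ∧
      ∃ p : V →ₗ[R] E, ∀ x : E, p x = x := by
  -- `E` is a maximal extension of `M` without new socle, and `K` below is maximal with `K ⊓ E = ⊥`.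
  -- Injectivity of `V` gives `g : V ⧸ K → V` restricting to the identity on `E`.
  obtain ⟨E, hME, hE⟩ := zorn_le_nonempty₀
    {E : Submodule R V | ∀ x ∈ E, (∀ a ∈ Ring.jacobson R, a • x = 0) → x ∈ M} (by
      intro c hc hchain y hy
      refine ⟨sSup c, fun x hx hJ => ?_, fun z hz => le_sSup hz⟩
      obtain ⟨z, hz, hxz⟩ := (Submodule.mem_sSup_of_directed ⟨y, hy⟩ hchain.directedOn).1 hx
      exact hc hz x hxz hJ) M fun x hx _ => hx
  obtain ⟨K, -, hK⟩ := zorn_le_nonempty₀ {K : Submodule R V | ∀ x ∈ K, x ∈ E → x = 0} (by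
      intro c hc hchain y hy
      refine ⟨sSup c, fun x hx hJ => ?_, fun z hz => le_sSup hz⟩
      obtain ⟨z, hz, hxz⟩ := (Submodule.mem_sSup_of_directed ⟨y, hy⟩ hchain.directedOn).1 hx
      exact hc hz x hxz hJ) ⊥ fun x hx _ => (Submodule.mem_bot R).1 hx
  have hKE := hK.prop
  have hinj : Function.Injective (K.mkQ ∘ₗ E.subtype) := by
    rw [← LinearMap.ker_eq_bot, LinearMap.ker_eq_bot']
    intro x hx
    exact Subtype.ext (hKE x ((Submodule.Quotient.mk_eq_zero K).1 hx) x.2)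
  obtain ⟨g, hg⟩ := hV.out (K.mkQ ∘ₗ E.subtype) hinj E.subtype
  have hgE : ∀ x ∈ E, g (K.mkQ x) = x := fun x hx => hg ⟨x, hx⟩
  -- Maximality of `K` makes `g` injective.
  have hgK : ∀ x, g (K.mkQ x) = 0 → x ∈ K := by
    have hle : K ≤ LinearMap.ker (g ∘ₗ K.mkQ) := fun x hx => by
      rw [LinearMap.mem_ker, LinearMap.comp_apply, K.mkQ_apply, (Submodule.Quotient.mk_eq_zero K).2 hx,
        map_zero]
    exact fun x hx => hK.le_of_ge (y := LinearMap.ker (g ∘ₗ K.mkQ))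
      (fun y hy hyE => (hgE y hyE).symm.trans hy) hle hx
  have hsoc : ∀ x, (∀ a ∈ Ring.jacobson R, a • g (K.mkQ x) = 0) → g (K.mkQ x) ∈ E := by
    intro x hx
    have hx' : ∀ a ∈ Ring.jacobson R, a • K.mkQ x = 0 := by
      intro a ha
      rw [← map_smul]
      refine (Submodule.Quotient.mk_eq_zero K).2 (hgK _ ?_)
      rw [map_smul, map_smul, hx a ha]
    let U := Submodule.span R {K.mkQ x}
    have hU : IsSemisimpleModule R U := by
      refine isSemisimpleModule_of_jacobson_smul_eq_zero U fun a ha y => Subtype.ext ?_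
      obtain ⟨r, hr⟩ := Submodule.mem_span_singleton.1 y.2
      change a • (y : V ⧸ K) = 0
      rw [← hr, ← mul_smul]
      exact hx' _ ((Ring.jacobson R).mul_mem_right r ha)
    -- The preimage of `C` in `V` contains `K` and meets `E` trivially, so it is `K` and `C = ⊥`.
    -- Thus the socle of `V ⧸ K` comes from `E`.
    obtain ⟨C, hC⟩ := exists_isCompl ((E.map K.mkQ).comap U.subtype)
    have hCbot : (C.map U.subtype).comap K.mkQ ≤ K := by
      refine hK.le_of_ge ?_ ?_
      · rintro y ⟨c, hc, hcy⟩ hyE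
        have hc0 : c = 0 := by
          have : c ∈ (E.map K.mkQ).comap U.subtype ⊓ C := ⟨⟨y, hyE, hcy.symm⟩, hc⟩
          rw [hC.inf_eq_bot] at this
          exact (Submodule.mem_bot R).1 this
        rw [hc0, map_zero] at hcy
        exact hKE y ((Submodule.Quotient.mk_eq_zero K).1 hcy.symm) hyE
      · intro y hy
        refine ⟨0, zero_mem _, ?_⟩
        rw [map_zero, K.mkQ_apply, (Submodule.Quotient.mk_eq_zero K).2 hy]
    have hC0 : C = ⊥ := by
      rw [eq_bot_iff]
      intro c hc
      obtain ⟨y, hy⟩ := K.mkQ_surjective (c : V ⧸ K)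
      have hyK : y ∈ K := hCbot ⟨c, hc, hy.symm⟩
      refine (Submodule.mem_bot R).2 (Subtype.ext ?_)
      rw [← hy]
      exact (Submodule.Quotient.mk_eq_zero K).2 hyK
    have htop : (E.map K.mkQ).comap U.subtype = ⊤ := by
      have := hC.sup_eq_top
      rwa [hC0, sup_bot_eq] at this
    have hxU : (⟨K.mkQ x, Submodule.mem_span_singleton_self _⟩ : U) ∈
        (E.map K.mkQ).comap U.subtype := htop ▸ Submodule.mem_top
    obtain ⟨e, he, hex⟩ := hxU
    change K.mkQ e = K.mkQ x at hex
    rw [← hex, hgE e he]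
    exact he
  -- The range of `g` contains `E` and has no new socle, so it is `E` by maximality, and `g ∘ₗ
  -- K.mkQ` is the retraction.
  have hrange : LinearMap.range g ≤ E := by
    refine hE.le_of_ge ?_ fun x hx => ⟨K.mkQ x, hgE x hx⟩
    rintro _ ⟨y, rfl⟩ hJ
    obtain ⟨x, rfl⟩ := K.mkQ_surjective y
    exact hE.prop _ (hsoc x hJ) hJ
  exact ⟨E, hME, hE.prop, (g ∘ₗ K.mkQ).codRestrict E fun x => hrange ⟨_, rfl⟩,
    fun x => Subtype.ext (hgE x x.2)⟩

end Socle

/-! ### Finitely generated cosyzygies over an artin algebra -/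

section FiniteInjective

variable (k : Type*) {R : Type u} [CommRing k] [IsArtinianRing k] [Ring R] [Algebra k R]
  [Module.Finite k R]

include k in
theorem isArtinianRing_of_algebra : IsArtinianRing R :=
  isArtinian_of_tower k inferInstance

include k in
/-- Over an artin algebra every finitely generated module has a finitely generated cosyzygy. -/
theorem exists_finite_isCosyzygy (M : ModuleCat.{u} R) [Module.Finite R M] :
    ∃ K : ModuleCat.{u} R, Module.Finite R K ∧ IsCosyzygy K M := by
  have : IsArtinianRing R := isArtinianRing_of_algebra k
  let ι : M ⟶ Injective.under M := Injective.ι M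
  let V := Injective.under M
  have hV : Module.Injective R V := (Module.injective_iff_injective_object R V).2
    (inferInstanceAs (Injective (Injective.under M)))
  obtain ⟨E, hME, hsoc, p, hp⟩ := exists_retract_same_socle hV (LinearMap.range ι.hom)
  let _ : Module k V := Module.compHom V (algebraMap k R)
  have : IsScalarTower k R V := ⟨fun c r x => by rw [Algebra.smul_def, mul_smul]; rfl⟩
  have hfin : Module.Finite R E := by
    refine finite_of_isNoetherian_annihilatedBy k E ?_
    have hnoeth : IsNoetherian k (LinearMap.range ι.hom) := by
      have : Module.Finite k (LinearMap.range ι.hom) := Module.Finite.trans R _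
      infer_instance
    let φ : annihilatedBy (Ring.jacobson R) E →ₗ[R] LinearMap.range ι.hom :=
      (E.subtype ∘ₗ (annihilatedBy (Ring.jacobson R) E).subtype).codRestrict _ fun x =>
        hsoc _ x.1.2 fun a ha => congr_arg Subtype.val (x.2 a ha)
    refine isNoetherian_of_injective (φ.restrictScalars k) fun x y hxy => ?_
    exact Subtype.ext (Subtype.ext (congr_arg (fun z : LinearMap.range ι.hom => (z : V)) hxy))
  have hEinj : Injective (ModuleCat.of R E) := by
    refine Retract.injective (Y := V) ⟨ModuleCat.ofHom E.subtype, ModuleCat.ofHom p, ?_⟩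
    ext x
    exact congr_arg Subtype.val (hp x)
  let j : M →ₗ[R] E := ι.hom.codRestrict E fun x => hME ⟨x, rfl⟩
  refine ⟨ModuleCat.of R (E ⧸ LinearMap.range j), ?_,
    ModuleCat.shortComplexOfCompEqZero j (LinearMap.range j).mkQ ?_,
    ModuleCat.shortComplex_shortExact _ ?_ ?_ ?_, hEinj, rfl, rfl⟩
  · exact inferInstanceAs (Module.Finite R (E ⧸ LinearMap.range j))
  · exact LinearMap.range_mkQ_comp j
  · exact LinearMap.exact_map_mkQ_range j
  · intro x y hxy
    refine (ModuleCat.mono_iff_injective ι).1 inferInstance ?_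
    exact congr_arg Subtype.val hxy
  · exact Submodule.mkQ_surjective _

include k in
theorem exists_bound_of_hasUltimatelyClosedInjectiveResolution {M : ModuleCat.{u} R}
    [Module.Finite R M] (h : HasUltimatelyClosedInjectiveResolution M) :
    ∃ t, ∀ N, ExtVanishesEventually N M → ExtVanishesAbove N M t := by
  obtain ⟨I, hI⟩ := h
  -- The cosyzygies of `I` may be infinitely generated, so a finitely generated sequence is built to
  -- compare with them.
  choose next hfin hcos using fun X : {X : ModuleCat.{u} R // Module.Finite R X} =>
    have := X.2
    exists_finite_isCosyzygy k X.1
  let Ω : ℕ → {X : ModuleCat.{u} R // Module.Finite R X} := fun n =>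
    Nat.rec ⟨M, inferInstance⟩ (fun _ X => ⟨next X, hfin X⟩) n
  have hΩ : ∀ n, IsCosyzygy (Ω (n + 1)).1 (Ω n).1 := fun n => hcos (Ω n)
  obtain ⟨W, hW, hWn⟩ := hI.exists_addGen AddGen.cosyzygy (isCosyzygy_cosyzygy I)
    (Ω' := fun n => (Ω n).1) hΩ rfl fun n => (Ω n).2
  exact exists_bound_of_isCosyzygy k (Ω := fun n => (Ω n).1) hΩ W 0 fun n _ => hWn n

end FiniteInjective

/-! ### Projective covers over an artinian ring -/

section ProjectiveCover

variable {R : Type u} [Ring R]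

theorem jacobson_module_le_smul_top [IsArtinianRing R] (V : Type*) [AddCommGroup V] [Module R V] :
    Module.jacobson R V ≤ Ring.jacobson R • (⊤ : Submodule R V) := by
  apply Module.jacobson_le_of_eq_bot
  have : IsSemisimpleModule R (V ⧸ Ring.jacobson R • (⊤ : Submodule R V)) := by
    refine isSemisimpleModule_of_jacobson_smul_eq_zero _ fun a ha x => ?_
    obtain ⟨x, rfl⟩ := Submodule.Quotient.mk_surjective _ x
    exact (Submodule.Quotient.mk_eq_zero _).2 (Submodule.smul_mem_smul ha trivial)
  exact IsSemisimpleModule.jacobson_eq_bot R _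

/-- A finitely generated module over an artinian ring is the image of a finitely generated
projective module under a map with kernel in the radical. -/
theorem exists_projective_ker_le_jacobson_smul [IsArtinianRing R] (M : Type u) [AddCommGroup M]
    [Module R M] [Module.Finite R M] :
    ∃ (P : Type u) (_ : AddCommGroup P) (_ : Module R P) (p : P →ₗ[R] M), Module.Finite R P ∧
      Module.Projective R P ∧ Function.Surjective p ∧
      LinearMap.ker p ≤ Ring.jacobson R • (⊤ : Submodule R P) := by
  obtain ⟨n, p, hp⟩ := Module.Finite.exists_fin' R M
  let K := LinearMap.ker p
  -- The cover is a minimal supplement `N` of `K`. A lift `φ` of `K.mkQ` to `N` is onto when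
  -- restricted to `N`, by minimality, hence bijective there, so `N` is a direct summand of a free
  -- module.
  obtain ⟨N, hN, hmin⟩ := IsArtinian.set_has_minimal
    {N : Submodule R (Fin n → R) | K ⊔ N = ⊤} ⟨⊤, sup_top_eq _⟩
  have hmin' : ∀ N', K ⊔ N' = ⊤ → N' ≤ N → N' = N := fun N' h₁ h₂ =>
    by_contra fun h => hmin N' h₁ (lt_of_le_of_ne h₂ h)
  have hNs : ∀ x, ∃ y ∈ N, x - y ∈ K := by
    intro x
    have hx : x ∈ K ⊔ N := by rw [hN]; trivial
    obtain ⟨a, ha, b, hb, rfl⟩ := Submodule.mem_sup.1 hx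
    exact ⟨b, hb, by rwa [add_sub_cancel_right]⟩
  have hsurj : Function.Surjective (K.mkQ ∘ₗ N.subtype) := by
    intro x
    obtain ⟨x, rfl⟩ := K.mkQ_surjective x
    obtain ⟨y, hy, hxy⟩ := hNs x
    exact ⟨⟨y, hy⟩, ((Submodule.Quotient.eq K).2 hxy).symm⟩
  obtain ⟨φ, hφ⟩ := Module.projective_lifting_property _ K.mkQ hsurj
  have hφK : ∀ x, x - (φ x : Fin n → R) ∈ K := fun x =>
    (Submodule.Quotient.eq K).1 (LinearMap.congr_fun hφ x).symm
  have hψ : Function.Surjective (φ ∘ₗ N.subtype) := by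
    have h : (LinearMap.range (φ ∘ₗ N.subtype)).map N.subtype = N := by
      refine hmin' _ ?_ (Submodule.map_subtype_le _ _)
      rw [eq_top_iff]
      intro x _
      obtain ⟨y, hy, hxy⟩ := hNs x
      refine Submodule.mem_sup.2 ⟨x - φ y, ?_, φ y, ⟨_, ⟨⟨y, hy⟩, rfl⟩, rfl⟩, sub_add_cancel _ _⟩
      have := add_mem hxy (hφK y)
      rwa [sub_add_sub_cancel] at this
    intro x
    obtain ⟨_, ⟨y, rfl⟩, hy⟩ := h.ge x.2
    exact ⟨y, Subtype.ext hy⟩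
  have hinj := IsNoetherian.injective_of_surjective_endomorphism _ hψ
  let e : N ≃ₗ[R] N := LinearEquiv.ofBijective (φ ∘ₗ N.subtype) ⟨hinj, hψ⟩
  have hproj : Module.Projective R N := by
    refine Module.Projective.of_split N.subtype (e.symm.toLinearMap ∘ₗ φ) ?_
    ext1 x
    exact e.symm_apply_apply x
  refine ⟨N, inferInstance, inferInstance, p ∘ₗ N.subtype, inferInstance, hproj, ?_, ?_⟩
  · intro x
    obtain ⟨x, rfl⟩ := hp x
    obtain ⟨y, hy, hxy⟩ := hNs x
    refine ⟨⟨y, hy⟩, ?_⟩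
    have := LinearMap.mem_ker.1 hxy
    rw [map_sub, sub_eq_zero] at this
    exact this.symm
  · refine le_trans ?_ (jacobson_module_le_smul_top N)
    -- A maximal submodule `C` of `N` not containing the kernel would be a smaller supplement of
    -- `K`.
    refine le_sInf fun C hC => ?_
    by_contra hKC
    have htop : LinearMap.ker (p ∘ₗ N.subtype) ⊔ C = ⊤ := by
      rw [sup_comm]
      exact hC.2 _ (left_lt_sup.2 hKC)
    have h : C.map N.subtype = N := by
      refine hmin' _ ?_ (Submodule.map_subtype_le _ _)
      rw [eq_top_iff]
      intro x _
      obtain ⟨y, hy, hxy⟩ := hNs x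
      have hy' : (⟨y, hy⟩ : N) ∈ LinearMap.ker (p ∘ₗ N.subtype) ⊔ C := by rw [htop]; trivial
      obtain ⟨a, ha, b, hb, hab⟩ := Submodule.mem_sup.1 hy'
      refine Submodule.mem_sup.2 ⟨x - b, ?_, b, ⟨b, hb, rfl⟩, sub_add_cancel _ _⟩
      have hab' : (a : Fin n → R) + b = y := congr_arg Subtype.val hab
      have := add_mem hxy (show (a : Fin n → R) ∈ K from ha)
      rwa [← hab', show x - ((a : Fin n → R) + b) + a = x - b by abel] at this
    refine hC.1 (Submodule.map_injective_of_injective N.injective_subtype ?_)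
    rw [h, Submodule.map_subtype_top]

/-- The kernel of the cover lies in Rad(R)P, so Rad^m(R) sends it into Rad^{m+1}(R)P = 0. -/
theorem exists_isSyzygy_jacobson_pow_smul_eq_zero [IsArtinianRing R] {m : ℕ}
    (hm : Ring.jacobson R ^ (m + 1) = ⊥) (M : ModuleCat.{u} R) [Module.Finite R M] :
    ∃ K : ModuleCat.{u} R, Module.Finite R K ∧ IsSyzygy K M ∧
      ∀ a ∈ Ring.jacobson R ^ m, ∀ x : K, a • x = 0 := by
  obtain ⟨P, _, _, p, hPf, hP, hp, hker⟩ := exists_projective_ker_le_jacobson_smul (R := R) M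
  refine ⟨ModuleCat.of R (LinearMap.ker p), ?_, ⟨p.shortComplexKer,
    LinearMap.shortExact_shortComplexKer hp, (IsProjective.iff_projective P).1 hP, rfl, rfl⟩, ?_⟩
  · exact inferInstanceAs (Module.Finite R (LinearMap.ker p))
  · rintro a ha ⟨x, hx⟩
    have h := Submodule.smul_mem_smul ha (hker hx)
    rw [← Submodule.mul_smul, ← Submodule.pow_succ, hm, Submodule.bot_smul] at h
    exact Subtype.ext ((Submodule.mem_bot R).1 h)

end ProjectiveCover

/-! ### Decomposition into indecomposables -/

section Indecomposable

variable {R : Type u} [Ring R]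

theorem finite_of_retract {X Y : ModuleCat.{u} R} (r : Retract X Y) [Module.Finite R Y] :
    Module.Finite R X :=
  Module.Finite.of_surjective r.r.hom fun x => ⟨r.i x, congr($(r.retract).hom x)⟩

theorem AddGen.of_retract {X Y : ModuleCat.{u} R} (r : Retract X Y) :
    AddGen (fun Z => Z = Y) X :=
  (AddGen.of_mem (C := fun Z => Z = Y) rfl).retract r.i r.r r.retract

theorem addGen_indecomposable_of_length (n : ℕ) (K : ModuleCat.{u} R)
    (hn : Module.length R K = n) :
    AddGen (fun Z => Indecomposable Z ∧ Nonempty (Retract Z K)) K := by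
  induction n using Nat.strong_induction_on generalizing K with
  | _ n ih =>
    by_cases h0 : Limits.IsZero K
    · unfold AddGen
      rw [h0.eq_of_src (𝟙 K) 0]
      exact zero_mem _
    by_cases h : Indecomposable K
    · exact .of_mem ⟨h, ⟨Retract.refl K⟩⟩
    · unfold Indecomposable at h
      push Not at h
      obtain ⟨Y, Z, e, hY, hZ⟩ := h h0
      let rY : Retract Y K := ⟨Limits.biprod.inl ≫ e.inv, e.hom ≫ Limits.biprod.fst, by simp⟩
      let rZ : Retract Z K := ⟨Limits.biprod.inr ≫ e.inv, e.hom ≫ Limits.biprod.snd, by simp⟩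
      have hYn : Nontrivial Y := not_subsingleton_iff_nontrivial.1 fun hs =>
        hY (ModuleCat.isZero_of_subsingleton Y)
      have hZn : Nontrivial Z := not_subsingleton_iff_nontrivial.1 fun hs =>
        hZ (ModuleCat.isZero_of_subsingleton Z)
      have hlen : Module.length R K = Module.length R Y + Module.length R Z := by
        rw [(e ≪≫ ModuleCat.biprodIsoProd Y Z).toLinearEquiv.length_eq]
        exact Module.length_prod R Y Z
      have hYt : Module.length R Y ≠ ⊤ := fun h => by
        rw [hn, h, top_add] at hlen; exact ENat.natCast_ne_top _ hlen
      have hZt : Module.length R Z ≠ ⊤ := fun h => by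
        rw [hn, h, add_top] at hlen; exact ENat.natCast_ne_top _ hlen
      obtain ⟨a, ha⟩ := ENat.ne_top_iff_exists.1 hYt
      obtain ⟨b, hb⟩ := ENat.ne_top_iff_exists.1 hZt
      have ha0 : 0 < a := by
        have := Module.length_pos (R := R) (M := Y)
        rw [← ha] at this
        exact_mod_cast this
      have hb0 : 0 < b := by
        have := Module.length_pos (R := R) (M := Z)
        rw [← hb] at this
        exact_mod_cast this
      have hab : n = a + b := by
        rw [hn, ← ha, ← hb] at hlen
        exact_mod_cast hlen
      have key : AddGen (fun X => X = Y ∨ X = Z) K := by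
        have e₁ : 𝟙 K = rY.r ≫ rY.i + rZ.r ≫ rZ.i := by
          rw [← cancel_epi e.inv, ← cancel_mono e.hom]
          simp [rY, rZ]
        unfold AddGen
        rw [e₁]
        exact add_mem (factor_mem (C := fun X => X = Y ∨ X = Z) (Or.inl rfl) _ _)
          (factor_mem (C := fun X => X = Y ∨ X = Z) (Or.inr rfl) _ _)
      refine key.trans ?_
      rintro _ (rfl | rfl)
      · refine (ih a (by omega) _ ha.symm).trans ?_
        rintro X ⟨hX, ⟨r⟩⟩
        exact .of_mem ⟨hX, ⟨r.trans rY⟩⟩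
      · refine (ih b (by omega) _ hb.symm).trans ?_
        rintro X ⟨hX, ⟨r⟩⟩
        exact .of_mem ⟨hX, ⟨r.trans rZ⟩⟩

/-- A module of finite length is a finite direct sum of indecomposable modules. -/
theorem addGen_indecomposable (K : ModuleCat.{u} R) [IsArtinian R K] [IsNoetherian R K] :
    AddGen (fun Z => Indecomposable Z ∧ Nonempty (Retract Z K)) K := by
  obtain ⟨n, hn⟩ := ENat.ne_top_iff_exists.1 (Module.length_ne_top (R := R) (M := K))
  exact addGen_indecomposable_of_length n K hn.symm

theorem AddGen.map {A B : Type*} [Category* A] [Category* B] [Preadditive A] [Preadditive B]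
    (F : A ⥤ B) [F.Additive] {C : A → Prop} {X : A} (hX : AddGen C X) :
    AddGen (fun Z => ∃ Z', C Z' ∧ Z = F.obj Z') (F.obj X) := by
  have key : ∀ f ∈ factorIdeal C X X,
      F.map f ∈ factorIdeal (fun Z => ∃ Z', C Z' ∧ Z = F.obj Z') (F.obj X) (F.obj X) := by
    intro f hf
    induction hf using AddSubgroup.closure_induction with
    | mem f hf =>
      obtain ⟨Z, hZ, i, p, rfl⟩ := hf
      rw [F.map_comp]
      exact factor_mem (C := fun Z => ∃ Z', C Z' ∧ Z = F.obj Z') ⟨Z, hZ, rfl⟩ _ _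
    | zero => rw [F.map_zero]; exact zero_mem _
    | add f g _ _ hf hg => rw [F.map_add]; exact add_mem hf hg
    | neg f _ hf => rw [F.map_neg]; exact neg_mem hf
  have := key _ hX
  rwa [F.map_id] at this

/-- A module of finite length annihilated by a two-sided ideal `I` decomposes into indecomposable
modules over the quotient ring. -/
theorem addGen_restrictScalars_indecomposable [IsArtinianRing R] (I : Ideal R) [I.IsTwoSided]
    (K : ModuleCat.{u} R) [Module.Finite R K] (hK : ∀ a ∈ I, ∀ x : K, a • x = 0) :
    AddGen (fun Z => ∃ X : ModuleCat.{u} (R ⧸ I), Indecomposable X ∧ Module.Finite (R ⧸ I) X ∧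
      Z = (ModuleCat.restrictScalars (Ideal.Quotient.mk I)).obj X ∧ Nonempty (Retract Z K)) K := by
  have ht : Module.IsTorsionBySet R K I := fun x a => hK a a.2 x
  let _ : Module (R ⧸ I) K := ht.module
  have : IsScalarTower R (R ⧸ I) K := ht.isScalarTower
  have hfin : Module.Finite (R ⧸ I) K := Module.Finite.of_restrictScalars_finite R (R ⧸ I) K
  have : IsArtinian (R ⧸ I) K := isArtinian_of_tower R inferInstance
  have : IsNoetherian (R ⧸ I) K := isNoetherian_of_tower R inferInstance
  let K' : ModuleCat.{u} (R ⧸ I) := ModuleCat.of (R ⧸ I) K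
  have : Module.Finite (R ⧸ I) K' := hfin
  have : IsArtinian (R ⧸ I) K' := ‹IsArtinian (R ⧸ I) K›
  have : IsNoetherian (R ⧸ I) K' := ‹IsNoetherian (R ⧸ I) K›
  let F := ModuleCat.restrictScalars.{u} (Ideal.Quotient.mk I)
  let e₀ : F.obj K' ≃ₗ[R] K :=
    { toFun := fun x => x
      invFun := fun x => x
      left_inv := fun _ => rfl
      right_inv := fun _ => rfl
      map_add' := fun _ _ => rfl
      map_smul' := fun r x => ht.mk_smul r x }
  let e : F.obj K' ≅ K := e₀.toModuleIso
  have h := ((addGen_indecomposable K').map F).retract e.inv e.hom e.inv_hom_id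
  refine h.trans ?_
  rintro _ ⟨X, ⟨hX, ⟨r⟩⟩, rfl⟩
  exact .of_mem ⟨X, hX, finite_of_retract r, rfl, ⟨(r.map F).trans (Retract.ofIso e)⟩⟩

end Indecomposable

/-! ### The uniform bound from finite representation type -/

section FiniteType

variable (k : Type*) {R : Type u} [CommRing k] [IsArtinianRing k] [Ring R] [Algebra k R]
  [Module.Finite k R]

include k in
theorem exists_bound_of_isFiniteRepresentationType {m : ℕ}
    (h : IsFiniteRepresentationType (R ⧸ (Ring.jacobson R) ^ m))
    (hm : Ring.jacobson R ^ (m + 1) = ⊥) :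
    ∃ t, ∀ M N : ModuleCat.{u} R, Module.Finite R M → ExtVanishesEventually M N →
      ExtVanishesAbove M N t := by
  have : IsArtinianRing R := isArtinianRing_of_algebra k
  obtain ⟨n, X, hX⟩ := h
  let Y : Fin n → ModuleCat.{u} R := fun i =>
    (ModuleCat.restrictScalars (Ideal.Quotient.mk (Ring.jacobson R ^ m))).obj (X i)
  have hsyz : ∀ M : {M : ModuleCat.{u} R // Module.Finite R M},
      ∃ K : {M : ModuleCat.{u} R // Module.Finite R M}, IsSyzygy K.1 M.1 ∧
        AddGen (fun Z => ∃ i, Z = Y i ∧ Nonempty (Retract Z K.1)) K.1 := by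
    rintro ⟨M, hM⟩
    obtain ⟨K, hKf, hKM, hK⟩ := exists_isSyzygy_jacobson_pow_smul_eq_zero hm M
    refine ⟨⟨K, hKf⟩, hKM, (addGen_restrictScalars_indecomposable _ K hK).trans ?_⟩
    rintro _ ⟨Z, hZ, hZf, rfl, ⟨r⟩⟩
    obtain ⟨i, ⟨e⟩⟩ := hX Z hZf hZ
    let e' := (ModuleCat.restrictScalars (Ideal.Quotient.mk (Ring.jacobson R ^ m))).mapIso e
    exact AddGen.retract (X := Y i) (.of_mem ⟨i, rfl, ⟨(Retract.ofIso e'.symm).trans r⟩⟩)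
      e'.hom e'.inv e'.hom_inv_id
  choose next hnext hgen using hsyz
  -- The representatives `X i` are not assumed finitely generated, so only the finitely generated `Y
  -- i` enter; those occurring as retracts of chosen syzygies are among them.
  obtain ⟨W, hW, hWY⟩ := exists_finite_addGen
    (fun i : {i // Module.Finite R (Y i)} => Y i.1) fun i => i.2
  have hgenW : ∀ M, AddGen (fun Z => Z = W) (next M).1 := by
    intro M
    refine (hgen M).trans ?_
    rintro _ ⟨i, rfl, ⟨r⟩⟩
    have := (next M).2
    exact hWY ⟨i, finite_of_retract r⟩
  have hbound : ∀ i : {i // Module.Finite R (Y i)}, ∃ t, ∀ N,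
      ExtVanishesEventually (Y i.1) N → ExtVanishesAbove (Y i.1) N t := by
    rintro ⟨i, hi⟩
    let Ω : ℕ → {X : ModuleCat.{u} R // Module.Finite R X} := fun n =>
      Nat.rec ⟨Y i, hi⟩ (fun _ X => next X) n
    refine exists_bound_of_isSyzygy k (Ω := fun n => (Ω n).1) (fun n => hnext (Ω n)) W 1 ?_
    intro n hn
    obtain ⟨n, rfl⟩ : ∃ l, n = l + 1 := ⟨n - 1, by omega⟩
    exact (hgenW (Ω n)).or_right
  choose t ht using hbound
  obtain ⟨T, hT⟩ := Finite.exists_le t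
  -- The extra one pays for passing from `M` to its syzygy `K`. Each `Y j` used is a retract of `K`,
  -- so it inherits eventual vanishing of Ext into `N`, and the bound `T` applies to it.
  refine ⟨T + 1, fun M N hM ⟨s, _, hs⟩ i hi => ?_⟩
  let K := next ⟨M, hM⟩
  have hKM : IsSyzygy K.1 M := hnext ⟨M, hM⟩
  have := K.2
  obtain ⟨i, rfl⟩ : ∃ l, i = l + 1 := ⟨i - 1, by omega⟩
  rw [← hKM.subsingleton_ext_iff N (by omega)]
  refine (hgen ⟨M, hM⟩).subsingleton_ext_left ?_
  rintro _ ⟨j, rfl, ⟨r⟩⟩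
  have hj : Module.Finite R (Y j) := finite_of_retract r
  have hev : ExtVanishesAbove (Y j) N s := by
    intro l hl
    refine (AddGen.of_retract r).subsingleton_ext_left ?_
    rintro _ rfl
    exact (hKM.subsingleton_ext_iff N (by omega)).2 (hs _ (by omega))
  exact ht ⟨j, hj⟩ N hev.eventually i (lt_of_le_of_lt (hT ⟨j, hj⟩) (by omega))

end FiniteType

end AuslanderBound

theorem proposition3p9 {k : Type*} {R : Type u} [CommRing k] [IsArtinianRing k]
    [Ring R] [Algebra k R] [Module.Finite k R] :
    (AuslanderBound.IsProjectiveUltimatelyClosedType R →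
      ∀ M : ModuleCat.{u} R, AuslanderBound.IsMod M →
        AuslanderBound.lAb AuslanderBound.IsMod M < ⊤) ∧
    (AuslanderBound.IsInjectiveUltimatelyClosedType R →
      ∀ M : ModuleCat.{u} R, AuslanderBound.IsMod M →
        AuslanderBound.rAb AuslanderBound.IsMod M < ⊤) ∧
    (AuslanderBound.IsProjectiveUltimatelyClosedType R → AuslanderBound.EWTC R) ∧
    (∀ m : ℕ, AuslanderBound.IsFiniteRepresentationType (R ⧸ (Ring.jacobson R) ^ m) →
      (Ring.jacobson R) ^ (m + 1) = ⊥ → AuslanderBound.gAb R < ⊤) := by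
  open AuslanderBound in
  refine ⟨fun h M hM => ?_, fun h M hM => ?_, fun h T hT hT₂ hT₃ => ?_, fun m h hm => ?_⟩
  · obtain ⟨t, ht⟩ := exists_bound_of_hasUltimatelyClosedProjectiveResolution k hM (h M hM.finite)
    exact lt_of_le_of_lt ((lAb_le_iff _ M t).2 fun N _ => ht N) (ENat.natCast_lt_top t)
  · have := hM.finite
    obtain ⟨t, ht⟩ := exists_bound_of_hasUltimatelyClosedInjectiveResolution k (h M hM.finite)
    exact lt_of_le_of_lt ((rAb_le_iff _ M t).2 fun N _ => ht N) (ENat.natCast_lt_top t)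
  · obtain ⟨t, ht⟩ := exists_bound_of_hasUltimatelyClosedProjectiveResolution k hT (h T hT.finite)
    obtain ⟨r, hr⟩ := hT₃.extVanishesAbove hT₂
    exact ⟨hT, finitePd_of_bound hT hT₂ hr ht, hT₂, hT₃⟩
  · obtain ⟨t, ht⟩ := exists_bound_of_isFiniteRepresentationType k h hm
    exact lt_of_le_of_lt (iSup₂_le fun M hM => (lAb_le_iff _ M t).2 fun N _ => ht M N hM.finite)
      (ENat.natCast_lt_top t)
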